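/- Let $(\mathcal X,\mathrm dx)$ be a measure space, $p$ a probability density on it, and for $\theta\in\mathbb R^m$ ($m\ge 1$), $\omega\in\mathbb R^n$ let $E_\theta,H_\omega:\mathcal X\to\mathbb R$ be measurable. Put $Z_\theta=\int \exp(-E_\theta(x))\,\mathrm dx$ and $q_\theta=\exp(-E_\theta)/Z_\theta$. Let $f$ be a strictly convex function on $(0,\infty)$ that is three times differentiable with $f(1)=0$ and $f''(1)>0$, let $f^*(y)=\sup_{u>0}\,(yu-f(u))$, and put $$A(u)=f'(e^u),\qquad B(u)=f^*(f'(e^u))-f^*(f'(1)),$$ $$V(\theta,\omega)=\mathbb E_{p(x)}[A(H_\omega(x)+E_\theta(x))]-\mathbb E_{q_\theta(x)}[B(H_\omega(x)+E_\theta(x))].$$ Consider the system $\dot\phi=v(\phi)$, $\phi=(\theta,\omega)$, $v(\theta,\omega)=(-\nabla_\theta V(\theta,\omega),\ \nabla_\omega V(\theta,\omega))$. Let $(\theta^*,\omega^*)$ be a point near which, for all $x$, $\theta\mapsto E_\theta(x)$ and $\omega\mapsto H_\omega(x)$ are twice differentiable on neighbourhoods not depending on $x$, and near which each of the integrands $e^{-E_\theta(x)}$,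 $p(x)A(H_\omega(x)+E_\theta(x))$, $e^{-E_\theta(x)}B(H_\omega(x)+E_\theta(x))$ and its first and second derivatives in the parameters are bounded by an integrable function of $x$ (so that differentiation under the integral sign is legitimate). Define $$K_{EE}=\mathbb E_p[\nabla_\theta E\,\nabla_\theta^\top E]-2\,\mathbb E_p[\nabla_\theta E]\,\mathbb E_p[\nabla_\theta^\top E],\quad K_{EH}=\mathbb E_p[\nabla_\theta E]\,\mathbb E_p[\nabla_\omega^\top H],\quad K_{HH}=\mathbb E_p[\nabla_\omega H\,\nabla_\omega^\top H],$$ evaluated at $(\theta^*,\omega^*)$. Assume 1. (realizability) $q_{\theta^*}(x)=p(x)$ and $H_{\omega^*}(x)=\log(p(x)Z_{\theta^*})$ for all $x\in\operatorname{supp}(p)=\{p\neq0\}$; 2. $K_{EE}$ is positive semi-definite; 3. $K_{HH}$ and $K_{EH}^\top$ have full column rank. Then $(\theta^*,\omega^*)$ is an equilibrium, $v$ is differentiable there, and the equilibrium is locally exponentially stable: solutions from nearby initial states exist for all $t\ge0$, the equilibrium is Lyapunov stable and asymptotically stable, and there are $\delta,k,r>0$ such that $\|\phi(0)-\phi^*\|<\delta$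 implies $\|\phi(t)-\phi^*\|\le k\|\phi(0)-\phi^*\|e^{-rt}$ for all $t\ge0$, where $\phi^*=(\theta^*,\omega^*)$. The rate of convergence is governed by the eigenvalues of the Jacobian $J$ of $v$ at $\phi^*$: every rate $r<\min_\lambda(-\operatorname{Re}\lambda)$ is attained (with suitable $\delta,k>0$), and no rate $r>\min_\lambda(-\operatorname{Re}\lambda)$ is. Write $\overline\lambda,\underline\lambda$ for the largest and smallest eigenvalue of a symmetric matrix and $\overline\lambda(K_{EE},K_{HH})=\max(\overline\lambda(K_{EE}),\overline\lambda(K_{HH}))$. Every complex eigenvalue $\lambda$ of $J$ satisfies $\operatorname{Re}\lambda<0$, and more precisely: - if $\operatorname{Im}\lambda=0$, then $$\operatorname{Re}\lambda<-\frac{f''(1)\,\underline\lambda(K_{HH})\,\underline\lambda(K_{EH}K_{EH}^\top)}{\underline\lambda(K_{HH})\,\overline\lambda(K_{EE},K_{HH})+\underline\lambda(K_{EH}K_{EH}^\top)}<0;$$ - if $\operatorname{Im}\lambda\ne0$, then $$\operatorname{Re}\lambda\le-\frac{f''(1)}2\bigl(\underline\lambda(K_{EE})+\underline\lambda(K_{HH})\bigr)<0.$$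 -/

import Mathlib

open MeasureTheory Set Filter Topology

noncomputable section

/-! ### Autonomous differential equations and stability of equilibria -/

section Stability

variable {W : Type*} [NormedAddCommGroup W] [NormedSpace ℝ W]

/-- `φ` solves `φ' = v(φ)` on the time set `I` (one-sided derivatives at end points in `I`). -/
def IsSolutionOn (v : W → W) (φ : ℝ → W) (I : Set ℝ) : Prop :=
  ∀ t ∈ I, HasDerivWithinAt φ (v (φ t)) I t

/-- All initial states near `z` have a solution on `[0, ∞)`. -/
def HasForwardSolutionsNear (v : W → W) (z : W) : Prop :=
  ∃ δ > 0, ∀ w : W, ‖w - z‖ < δ → ∃ φ : ℝ → W, φ 0 = w ∧ IsSolutionOn v φ (Ici 0)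

/-- Stability in the sense of Lyapunov. Solutions on bounded intervals `[0, T)` are included, so
that no solution near `z` can escape in finite time. -/
def IsStable (v : W → W) (z : W) : Prop :=
  ∀ ε > 0, ∃ δ > 0, ∀ (φ : ℝ → W) (T : ℝ), IsSolutionOn v φ (Ico 0 T) → ‖φ 0 - z‖ < δ →
    ∀ t ∈ Ico 0 T, ‖φ t - z‖ < ε

/-- Asymptotic stability. -/
def IsAsymptoticallyStable (v : W → W) (z : W) : Prop :=
  IsStable v z ∧ ∃ δ > 0, ∀ φ : ℝ → W, IsSolutionOn v φ (Ici 0) → ‖φ 0 - z‖ < δ →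
    Tendsto φ atTop (𝓝 z)

/-- Solutions that start near `z` obey `‖φ(t) - z‖ ≤ k ‖φ(0) - z‖ exp (-r t)`. -/
def HasExponentialRate (v : W → W) (z : W) (r : ℝ) : Prop :=
  ∃ δ > 0, ∃ k > 0, ∀ (φ : ℝ → W) (T : ℝ), IsSolutionOn v φ (Ico 0 T) → ‖φ 0 - z‖ < δ →
    ∀ t ∈ Ico 0 T, ‖φ t - z‖ ≤ k * ‖φ 0 - z‖ * Real.exp (-r * t)

/-- Local exponential stability of the equilibrium `z` of `φ' = v(φ)`. -/
structure IsExponentiallyStable (v : W → W) (z : W) : Prop where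
  equilibrium : v z = 0
  solutions : HasForwardSolutionsNear v z
  asymptotic : IsAsymptoticallyStable v z
  rate : ∃ r > 0, HasExponentialRate v z r

end Stability

/-! ### Matrices -/

section Matrices

/-- The set of eigenvalues in `𝕜` of a square matrix over `𝕜`. -/
def eigenvalueSet {𝕜 ι : Type*} [Field 𝕜] [Fintype ι] [DecidableEq ι] (M : Matrix ι ι 𝕜) : Set 𝕜 :=
  {c | Module.End.HasEigenvalue (Matrix.toLin' M) c}

/-- Largest eigenvalue; for a symmetric matrix of positive size the set is finite and non-empty. -/
def eigMax {d : ℕ} (M : Matrix (Fin d) (Fin d) ℝ) : ℝ := sSup (eigenvalueSet M)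

/-- Smallest eigenvalue; for a symmetric matrix of positive size the set is finite and non-empty. -/
def eigMin {d : ℕ} (M : Matrix (Fin d) (Fin d) ℝ) : ℝ := sInf (eigenvalueSet M)

/-- The rank is the number of columns. -/
def FullColumnRank {k d : ℕ} (M : Matrix (Fin k) (Fin d) ℝ) : Prop := M.rank = d

end Matrices

/-! ### Generator functions of f-divergences -/

/-- The Fenchel conjugate `f*(y) = sup_u (y u - f u)` of a generator `f`. Only the values of `f` on
`(0, ∞)` are used: for a closed convex `f` on `[0, ∞)` the value at `0` is the (possibly infinite)
limit at `0+` and does not change the supremum. The supremum is finite at every `y = f'(u)` with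
`u > 0`, and only such `y` occur below. -/
def fenchelConjugate (f : ℝ → ℝ) (y : ℝ) : ℝ := sSup ((fun u => y * u - f u) '' Ioi 0)

/-- Generator functions: strictly convex on `(0, ∞)`, zero at `1`, three times differentiable,
and with positive second derivative at `1`. -/
structure IsGenerator (f : ℝ → ℝ) : Prop where
  strictConvex : StrictConvexOn ℝ (Ioi 0) f
  map_one : f 1 = 0
  diff₁ : DifferentiableOn ℝ f (Ioi 0)
  diff₂ : DifferentiableOn ℝ (deriv f) (Ioi 0)
  diff₃ : DifferentiableOn ℝ (deriv (deriv f)) (Ioi 0)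
  second_pos : 0 < deriv (deriv f) 1

/-! ### Regularity in the parameters -/

/-- `g` is twice Fréchet differentiable on `U`. -/
def TwiceDifferentiableOn {W : Type*} [NormedAddCommGroup W] [NormedSpace ℝ W]
    (g : W → ℝ) (U : Set W) : Prop :=
  DifferentiableOn ℝ g U ∧ DifferentiableOn ℝ (fderiv ℝ g) U

/-- The domination condition of the Leibniz integral rule up to order two near `w₀`: the integrand
and its first two derivatives in the parameter have a common integrable bound. -/
def LocallyDominated {𝒳 W : Type*} [MeasurableSpace 𝒳] [NormedAddCommGroup W] [NormedSpace ℝ W]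
    (μ : Measure 𝒳) (Φ : 𝒳 → W → ℝ) (w₀ : W) : Prop :=
  ∃ U : Set W, IsOpen U ∧ w₀ ∈ U ∧ ∃ g : 𝒳 → ℝ, Integrable g μ ∧ ∀ᵐ x ∂μ, ∀ w ∈ U,
    |Φ x w| ≤ g x ∧ ‖fderiv ℝ (Φ x) w‖ ≤ g x ∧ ‖fderiv ℝ (fderiv ℝ (Φ x)) w‖ ≤ g x

/-! ### The f-EBM minimax game -/

/-- The data of an f-EBM: base measure, data density `p`, energy functions `E θ`, variational
functions `H ω` (`θ ∈ ℝᵐ`, `ω ∈ ℝⁿ`) and the generator `f`. Models whose parameters range over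
open sets are included, since below only parameters near one point matter. -/
structure FEBM (𝒳 : Type*) [MeasurableSpace 𝒳] (m n : ℕ) where
  base : Measure 𝒳
  p : 𝒳 → ℝ
  E : EuclideanSpace ℝ (Fin m) → 𝒳 → ℝ
  H : EuclideanSpace ℝ (Fin n) → 𝒳 → ℝ
  f : ℝ → ℝ

namespace FEBM

variable {𝒳 : Type*} [MeasurableSpace 𝒳] {m n : ℕ} (M : FEBM 𝒳 m n)

/-- The partition function. -/
def Z (θ : EuclideanSpace ℝ (Fin m)) : ℝ := ∫ x, Real.exp (-M.E θ x) ∂M.base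

/-- The density of the energy-based model. -/
def q (θ : EuclideanSpace ℝ (Fin m)) (x : 𝒳) : ℝ := Real.exp (-M.E θ x) / M.Z θ

def A (u : ℝ) : ℝ := deriv M.f (Real.exp u)

def B (u : ℝ) : ℝ :=
  fenchelConjugate M.f (deriv M.f (Real.exp u)) - fenchelConjugate M.f (deriv M.f 1)

/-- The minimax objective. -/
def V (θ : EuclideanSpace ℝ (Fin m)) (ω : EuclideanSpace ℝ (Fin n)) : ℝ :=
  (∫ x, M.p x * M.A (M.H ω x + M.E θ x) ∂M.base) -
    ∫ x, M.q θ x * M.B (M.H ω x + M.E θ x) ∂M.base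

/-- The vector field of simultaneous gradient descent in `θ` and ascent in `ω`. -/
def field (z : EuclideanSpace ℝ (Fin m) × EuclideanSpace ℝ (Fin n)) :
    EuclideanSpace ℝ (Fin m) × EuclideanSpace ℝ (Fin n) :=
  (-gradient (fun θ => M.V θ z.2) z.1, gradient (fun ω => M.V z.1 ω) z.2)

/-- The Jacobian matrix of the vector field in the standard coordinates. -/
def jacobian (z : EuclideanSpace ℝ (Fin m) × EuclideanSpace ℝ (Fin n)) :
    Matrix (Fin m ⊕ Fin n) (Fin m ⊕ Fin n) ℝ :=
  let b := (EuclideanSpace.basisFun (Fin m) ℝ).toBasis.prod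
    (EuclideanSpace.basisFun (Fin n) ℝ).toBasis
  LinearMap.toMatrix b b (fderiv ℝ M.field z : _ →ₗ[ℝ] _)

/-- The complex eigenvalues of the Jacobian matrix. -/
def jacobianEigenvalues (z : EuclideanSpace ℝ (Fin m) × EuclideanSpace ℝ (Fin n)) : Set ℂ :=
  eigenvalueSet ((M.jacobian z).map ((↑) : ℝ → ℂ))

/-- Expectation under the data density. -/
def expect (g : 𝒳 → ℝ) : ℝ := ∫ x, M.p x * g x ∂M.base

def gradE (θ : EuclideanSpace ℝ (Fin m)) (x : 𝒳) : EuclideanSpace ℝ (Fin m) :=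
  gradient (fun θ' => M.E θ' x) θ

def gradH (ω : EuclideanSpace ℝ (Fin n)) (x : 𝒳) : EuclideanSpace ℝ (Fin n) :=
  gradient (fun ω' => M.H ω' x) ω

def KEE (θ : EuclideanSpace ℝ (Fin m)) : Matrix (Fin m) (Fin m) ℝ :=
  Matrix.of fun i j => M.expect (fun x => M.gradE θ x i * M.gradE θ x j) -
    2 * (M.expect (fun x => M.gradE θ x i) * M.expect (fun x => M.gradE θ x j))

def KEH (θ : EuclideanSpace ℝ (Fin m)) (ω : EuclideanSpace ℝ (Fin n)) :
    Matrix (Fin m) (Fin n) ℝ :=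
  Matrix.of fun i j => M.expect (fun x => M.gradE θ x i) * M.expect (fun x => M.gradH ω x j)

def KHH (ω : EuclideanSpace ℝ (Fin n)) : Matrix (Fin n) (Fin n) ℝ :=
  Matrix.of fun i j => M.expect (fun x => M.gradH ω x i * M.gradH ω x j)

/-- Standing assumptions near `(θ₀, ω₀)`: `f` is a generator, `p` is a probability density, `E` and
`H` are measurable in `x` and twice differentiable in the parameters, and the three integrands that
make up the objective may be differentiated twice under the integral sign by domination. In
particular the partition function is finite near `θ₀`. -/
structure Regular (θ₀ : EuclideanSpace ℝ (Fin m)) (ω₀ : EuclideanSpace ℝ (Fin n)) : Prop where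
  generator : IsGenerator M.f
  p_measurable : Measurable M.p
  p_nonneg : ∀ x, 0 ≤ M.p x
  p_integral : ∫ x, M.p x ∂M.base = 1
  E_measurable : ∀ θ, Measurable (M.E θ)
  H_measurable : ∀ ω, Measurable (M.H ω)
  E_diff : ∃ U, IsOpen U ∧ θ₀ ∈ U ∧ ∀ x, TwiceDifferentiableOn (fun θ => M.E θ x) U
  H_diff : ∃ U, IsOpen U ∧ ω₀ ∈ U ∧ ∀ x, TwiceDifferentiableOn (fun ω => M.H ω x) U
  dom_exp : LocallyDominated M.base (fun x θ => Real.exp (-M.E θ x)) θ₀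
  dom_A : LocallyDominated M.base
    (fun x (z : EuclideanSpace ℝ (Fin m) × EuclideanSpace ℝ (Fin n)) =>
      M.p x * M.A (M.H z.2 x + M.E z.1 x)) (θ₀, ω₀)
  dom_B : LocallyDominated M.base
    (fun x (z : EuclideanSpace ℝ (Fin m) × EuclideanSpace ℝ (Fin n)) =>
      Real.exp (-M.E z.1 x) * M.B (M.H z.2 x + M.E z.1 x)) (θ₀, ω₀)

/-- Realizability at `(θ₀, ω₀)`. -/
def Realizable (θ₀ : EuclideanSpace ℝ (Fin m)) (ω₀ : EuclideanSpace ℝ (Fin n)) : Prop :=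
  ∀ x ∈ Function.support M.p, M.q θ₀ x = M.p x ∧ M.H ω₀ x = Real.log (M.p x * M.Z θ₀)

end FEBM

end

/-!
The field `v` is built from the derivative of the objective `V`. Domination allows `V` to be
differentiated twice under the integral sign, so `v` is differentiable at the point in question and
Lipschitz near it (`LocallyDominated.leibniz`, `FEBM.Regular.objective`).

Realizability makes `p = q > 0` and `H + E = 0` hold almost everywhere
(`FEBM.Regular.Z_pos_and_ae`). Since `B' = exp · A'`, all second derivatives of `E` and `H` then
cancel from the second derivative of `V` (`fderiv_fderiv_sub_apply`), and the Jacobian of `v` is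
`f''(1)` times the block matrix with rows `(-K_EE, K_EH)` and `(-K_EHᵀ, -K_HH)`
(`FEBM.Regular.jacobian_eq`).

For an eigenvector `(x, y)` of this block matrix, the real part of the eigenvalue times
`|x|² + |y|²` is minus the sum of the forms `K_EE` at `x` and `K_HH` at `y`. For a non-real
eigenvalue the off-diagonal blocks force `|x| = |y|`, which gives the bound in that case
(`re_le_of_complex_eigenvector`). For a real eigenvalue `c` above the asserted bound, `K_HH + c`
would be positive definite, and eliminating `y` leads to a contradiction
(`lt_of_real_eigenvector`).

Stability and the range of exponential rates follow from a general form of Lyapunov's indirect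
method (`isExponentiallyStable_of_eigenvalueSet`). Its core is that on bounded time intervals the
nonlinear flow agrees with the linearized flow `exp (t J)` to first order in the distance from the
equilibrium, by Grönwall's inequality (`exists_norm_sub_exp_smul_le`). Iterating this over long time
steps transfers decay from the linear to the nonlinear flow; shrinking the initial distance
transfers it back. The growth of `exp (t J)` is read off from the generalized eigenspaces of the
complexified Jacobian.
-/

noncomputable section

/-! ### Linearized stability for locally Lipschitz vector fields -/

section LinearizedStability

open NormedSpace (exp)
open scoped NNReal

variable {W : Type*} [NormedAddCommGroup W] [NormedSpace ℝ W] {v : W → W} {z : W} {φ : ℝ → W}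

lemma IsSolutionOn.mono {I I' : Set ℝ} (h : IsSolutionOn v φ I) (hI : I' ⊆ I) :
    IsSolutionOn v φ I' :=
  fun t ht => (h t (hI ht)).mono hI

lemma IsSolutionOn.continuousOn {I : Set ℝ} (h : IsSolutionOn v φ I) : ContinuousOn φ I :=
  fun t ht => (h t ht).continuousWithinAt

lemma IsSolutionOn.hasDerivWithinAt_Ici {T t : ℝ} (h : IsSolutionOn v φ (Ico 0 T))
    (ht : t ∈ Ico 0 T) : HasDerivWithinAt φ (v (φ t)) (Ici t) t := by
  have h1 : HasDerivWithinAt φ (v (φ t)) (Ico t T) t :=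
    (h t ht).mono (Ico_subset_Ico_left ht.1)
  exact h1.mono_of_mem_nhdsWithin (Ico_mem_nhdsGE ht.2)

lemma IsSolutionOn.shift {T s : ℝ} (h : IsSolutionOn v φ (Ico 0 T)) (hs : 0 ≤ s) :
    IsSolutionOn v (fun t => φ (s + t)) (Ico 0 (T - s)) := by
  intro t ht
  have h1 := h (s + t) ⟨add_nonneg hs ht.1, by linarith [ht.2]⟩
  have h2 : HasDerivWithinAt (fun t : ℝ => s + t) 1 (Ico 0 (T - s)) t :=
    ((hasDerivAt_id t).const_add s).hasDerivWithinAt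
  have h3 := h1.scomp t h2 (fun u hu => ⟨add_nonneg hs hu.1, by linarith [hu.2]⟩)
  simpa [Function.comp_def] using h3

/-- As long as it stays in a ball on which `v` is Lipschitz, a solution separates from the
equilibrium at most exponentially; a first-exit-time argument shows that it does stay there. -/
lemma IsSolutionOn.norm_sub_le_exp {K : ℝ≥0} {R T : ℝ} (hz : v z = 0)
    (hL : LipschitzOnWith K v (Metric.closedBall z R)) (hφ : IsSolutionOn v φ (Ico 0 T))
    (h0 : ‖φ 0 - z‖ * Real.exp (K * T) < R) :
    ∀ t ∈ Ico 0 T, ‖φ t - z‖ ≤ ‖φ 0 - z‖ * Real.exp (K * t) ∧ ‖φ t - z‖ < R := by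
  have hR : 0 < R := lt_of_le_of_lt (by positivity) h0
  have growth : ∀ t ∈ Ico 0 T, (∀ s ∈ Ico 0 t, ‖φ s - z‖ < R) →
      ‖φ t - z‖ ≤ ‖φ 0 - z‖ * Real.exp (K * t) := by
    intro t ht hs
    have := dist_le_of_trajectories_ODE_of_mem (v := fun _ => v)
      (s := fun _ => Metric.closedBall z R) (K := K) (f := φ) (g := fun _ => z) (a := 0) (b := t)
      (δ := ‖φ 0 - z‖)
      (fun _ _ => hL) (hφ.continuousOn.mono (fun s hs => ⟨hs.1, hs.2.trans_lt ht.2⟩))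
      (fun s hs => hφ.hasDerivWithinAt_Ici ⟨hs.1, hs.2.trans ht.2⟩)
      (fun s hs' => by simpa [dist_eq_norm] using (hs s hs').le)
      continuousOn_const (fun s _ => by simpa [hz] using hasDerivWithinAt_const s (Ici s) z)
      (fun _ _ => Metric.mem_closedBall_self hR.le) (by simp [dist_eq_norm]) t ⟨ht.1, le_rfl⟩
    simpa [dist_eq_norm] using this
  have expT : ∀ t ∈ Ico 0 T, ‖φ 0 - z‖ * Real.exp (K * t) < R := by
    intro t ht
    refine lt_of_le_of_lt ?_ h0
    have := ht.2.le
    gcongr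
  have stay : ∀ t ∈ Ico 0 T, ‖φ t - z‖ < R := by
    by_contra! hcon
    obtain ⟨t₁, ht₁, hR₁⟩ := hcon
    have hc : ContinuousOn (fun t => ‖φ t - z‖) (Icc 0 t₁) :=
      ((hφ.continuousOn.mono (fun s hs => ⟨hs.1, hs.2.trans_lt ht₁.2⟩)).sub
        continuousOn_const).norm
    have hcomp : IsCompact (Icc 0 t₁ ∩ (fun t => ‖φ t - z‖) ⁻¹' Ici R) :=
      isCompact_Icc.of_isClosed_subset
        (hc.preimage_isClosed_of_isClosed isClosed_Icc isClosed_Ici) inter_subset_left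
    obtain ⟨t₂, ⟨ht₂, hR₂⟩, hmin⟩ := hcomp.exists_isLeast ⟨t₁, ⟨ht₁.1, le_rfl⟩, hR₁⟩
    have ht₂' : t₂ ∈ Ico 0 T := ⟨ht₂.1, ht₂.2.trans_lt ht₁.2⟩
    have := growth t₂ ht₂' (fun s hs => by
      by_contra! hns
      exact absurd (hmin ⟨⟨hs.1, hs.2.le.trans ht₂.2⟩, hns⟩) (not_le.2 hs.2))
    exact absurd (this.trans_lt (expT t₂ ht₂')) (not_lt.2 hR₂)
  exact fun t ht => ⟨growth t ht fun s hs => stay s ⟨hs.1, hs.2.trans ht.2⟩, stay t ht⟩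

lemma hasDerivAt_exp_smul_apply [CompleteSpace W] (J : W →L[ℝ] W) (w : W) (t : ℝ) :
    HasDerivAt (fun s : ℝ => exp (s • J) w) (J (exp (t • J) w)) t := by
  have h := (hasDerivAt_exp_smul_const' (𝕂 := ℝ) J t).clm_apply (hasDerivAt_const t w)
  simpa using h

/-- On bounded time intervals, the linearized flow approximates the flow near the equilibrium to
first order. Both the attainability of exponential rates and its converse rest on this. -/
lemma exists_norm_sub_exp_smul_le [CompleteSpace W] {K : ℝ≥0} {R : ℝ} {J : W →L[ℝ] W}
    (hz : v z = 0) (hR : 0 < R) (hL : LipschitzOnWith K v (Metric.closedBall z R))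
    (hJ : HasFDerivAt v J z) {T ε : ℝ} (hT : 0 ≤ T) (hε : 0 < ε) :
    ∃ δ > 0, ∀ (φ : ℝ → W) (T' : ℝ), IsSolutionOn v φ (Ico 0 T') → ‖φ 0 - z‖ < δ →
      ∀ t ∈ Ico 0 T', t ≤ T →
        ‖φ t - z - exp (t • J) (φ 0 - z)‖ ≤ ε * ‖φ 0 - z‖ := by
  set G := gronwallBound 0 ‖J‖ 1 T with hG
  have hgb : ∀ e x : ℝ, gronwallBound 0 ‖J‖ e x = e * gronwallBound 0 ‖J‖ 1 x := by
    intro e x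
    unfold gronwallBound
    split_ifs <;> ring
  have hG0 : 0 ≤ G := by
    have := gronwallBound_mono (δ := 0) (ε := 1) (K := ‖J‖) le_rfl zero_le_one (norm_nonneg _) hT
    simpa [gronwallBound_x0] using this
  -- `X` bounds the growth of a solution up to time `T`, and `G` the accumulation of a unit error;
  -- `η` is the accuracy of the linearization that keeps the total error below `ε`
  set X := Real.exp (K * (T + 1)) with hX
  have hX0 : 0 < X := Real.exp_pos _
  set η := ε / (X * (G + 1)) with hη
  have hη0 : 0 < η := by positivity
  obtain ⟨ρ, hρ0, hρ⟩ := Metric.eventually_nhds_iff.1 (hJ.isLittleO.def hη0)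
  refine ⟨min R ρ / X, by positivity, fun φ T' hφ h0 t ht htT => ?_⟩
  rw [lt_div_iff₀ hX0] at h0
  have hφ' : IsSolutionOn v φ (Ico 0 (min T' (T + 1))) :=
    hφ.mono (Ico_subset_Ico_right (min_le_left _ _))
  have hgrow := hφ'.norm_sub_le_exp (R := min R ρ) hz
    (hL.mono (Metric.closedBall_subset_closedBall (min_le_left _ _)))
    (lt_of_le_of_lt (by rw [hX]; gcongr; exact min_le_right T' (T + 1)) h0)
  have hmem : ∀ s ∈ Icc 0 t, s ∈ Ico 0 (min T' (T + 1)) := fun s hs =>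
    ⟨hs.1, lt_min (hs.2.trans_lt ht.2) (by linarith [hs.2])⟩
  have key := dist_le_of_approx_trajectories_ODE (v := fun _ => J) (K := ‖J‖₊)
    (f := fun s => φ s - z) (f' := fun s => v (φ s)) (g := fun s => exp (s • J) (φ 0 - z))
    (g' := fun s => J (exp (s • J) (φ 0 - z))) (a := 0) (b := t) (δ := 0)
    (εf := η * (‖φ 0 - z‖ * X)) (εg := 0) (fun _ => J.lipschitz)
    ((hφ'.continuousOn.mono hmem).sub continuousOn_const)
    (fun s hs => (hφ'.hasDerivWithinAt_Ici (hmem s ⟨hs.1, hs.2.le⟩)).sub_const z)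
    (fun s hs => by
      obtain ⟨h1, h2⟩ := hgrow s (hmem s ⟨hs.1, hs.2.le⟩)
      have h3 := hρ (show dist (φ s) z < ρ by
        rw [dist_eq_norm]; exact h2.trans_le (min_le_right _ _))
      rw [hz, sub_zero] at h3
      rw [dist_eq_norm]
      refine h3.trans ?_
      have h4 : Real.exp (K * s) ≤ X := by
        rw [hX]
        have : s ≤ T + 1 := by linarith [hs.2]
        gcongr
      gcongr
      exact h1.trans (by gcongr))
    (fun s _ => (hasDerivAt_exp_smul_apply J _ s).continuousAt.continuousWithinAt)
    (fun s _ => (hasDerivAt_exp_smul_apply J _ s).hasDerivWithinAt)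
    (fun s _ => by simp) (by simp) t ⟨ht.1, le_rfl⟩
  rw [dist_eq_norm, sub_zero, add_zero, coe_nnnorm, hgb] at key
  refine key.trans ?_
  have hmono : gronwallBound 0 ‖J‖ 1 t ≤ G :=
    gronwallBound_mono le_rfl zero_le_one (norm_nonneg _) htT
  calc η * (‖φ 0 - z‖ * X) * gronwallBound 0 ‖J‖ 1 t
      ≤ η * (‖φ 0 - z‖ * X) * (G + 1) := by gcongr; linarith
    _ = ε * ‖φ 0 - z‖ := by rw [hη]; field_simp

/-- A decay rate of the linearized flow is inherited, with an arbitrarily small loss, by the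
nonlinear flow: over one time step of suitable length the nonlinear flow contracts, and steps can
be iterated. -/
lemma hasExponentialRate_of_norm_exp_smul_le [CompleteSpace W] {K : ℝ≥0} {R : ℝ} {J : W →L[ℝ] W}
    (hz : v z = 0) (hR : 0 < R) (hL : LipschitzOnWith K v (Metric.closedBall z R))
    (hJ : HasFDerivAt v J z) {C r r' : ℝ} (hr : 0 ≤ r) (hrr' : r < r')
    (hC : ∀ t : ℝ, 0 ≤ t → ‖exp (t • J)‖ ≤ C * Real.exp (-r' * t)) :
    HasExponentialRate v z r := by
  have hC0 : 0 ≤ C := by simpa using (norm_nonneg _).trans (hC 0 le_rfl)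
  -- a time step so long that the loss from `r'` to `r` absorbs the constant `C` with a factor `2`
  -- to spare, which leaves room for the linearization error
  obtain ⟨T, hT1, hT2⟩ : ∃ T : ℝ, 1 ≤ T ∧ 2 * C ≤ Real.exp ((r' - r) * T) := by
    have h1 : Tendsto (fun T : ℝ => Real.exp ((r' - r) * T)) atTop atTop :=
      Real.tendsto_exp_atTop.comp (tendsto_id.const_mul_atTop (by linarith))
    exact ((eventually_ge_atTop 1).and (h1.eventually_ge_atTop (2 * C))).exists
  have hstep : C * Real.exp (-r' * T) ≤ Real.exp (-r * T) / 2 := by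
    have : Real.exp (-r * T) = Real.exp ((r' - r) * T) * Real.exp (-r' * T) := by
      rw [← Real.exp_add]; ring_nf
    rw [this]
    nlinarith [Real.exp_pos (-r' * T)]
  obtain ⟨δ, hδ, hcmp⟩ := exists_norm_sub_exp_smul_le hz hR hL hJ (T := T)
    (ε := Real.exp (-r * T) / 2) (by linarith) (by positivity)
  have hbd : ∀ (φ : ℝ → W) (T' : ℝ), IsSolutionOn v φ (Ico 0 T') → ‖φ 0 - z‖ < δ →
      ∀ t ∈ Ico 0 T', t ≤ T →
      ‖φ t - z‖ ≤ (C * Real.exp (-r' * t) + Real.exp (-r * T) / 2) * ‖φ 0 - z‖ := by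
    intro φ T' hφ h0 t ht htT
    have h1 := hcmp φ T' hφ h0 t ht htT
    have h2 : ‖exp (t • J) (φ 0 - z)‖ ≤ C * Real.exp (-r' * t) * ‖φ 0 - z‖ :=
      ((exp (t • J)).le_opNorm _).trans (by gcongr; exact hC t ht.1)
    have h3 := norm_sub_norm_le (φ t - z) (exp (t • J) (φ 0 - z))
    linarith
  set k := (C + 1) * Real.exp (r * T) with hk
  have hk0 : 0 < k := by positivity
  have main : ∀ n : ℕ, ∀ (φ : ℝ → W) (T' : ℝ), IsSolutionOn v φ (Ico 0 T') → ‖φ 0 - z‖ < δ →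
      ∀ t ∈ Ico 0 T', t < n * T → ‖φ t - z‖ ≤ k * ‖φ 0 - z‖ * Real.exp (-r * t) := by
    intro n
    induction n with
    | zero => intro φ T' _ _ t ht h; simp at h; linarith [ht.1]
    | succ n ih =>
      intro φ T' hφ h0 t ht htn
      rcases lt_or_ge t T with htT | htT
      · have h1 := hbd φ T' hφ h0 t ht htT.le
        have h2 : Real.exp (-r' * t) ≤ 1 := Real.exp_le_one_iff.2 (by nlinarith [ht.1])
        have h3 : Real.exp (-r * T) ≤ 1 := Real.exp_le_one_iff.2 (by nlinarith)
        have h4 : C * Real.exp (-r' * t) + Real.exp (-r * T) / 2 ≤ C + 1 := by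
          nlinarith
        have h5 : 1 ≤ Real.exp (r * T) * Real.exp (-r * t) := by
          rw [← Real.exp_add]
          exact Real.one_le_exp (by nlinarith)
        calc ‖φ t - z‖ ≤ (C + 1) * ‖φ 0 - z‖ := h1.trans (by gcongr)
          _ ≤ (C + 1) * ‖φ 0 - z‖ * (Real.exp (r * T) * Real.exp (-r * t)) :=
            le_mul_of_one_le_right (by positivity) h5
          _ = _ := by rw [hk]; ring
      · have hT' : T ∈ Ico 0 T' := ⟨by linarith, htT.trans_lt ht.2⟩
        have h1 := hbd φ T' hφ h0 T hT' le_rfl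
        have h2 : ‖φ T - z‖ ≤ Real.exp (-r * T) * ‖φ 0 - z‖ :=
          h1.trans (by gcongr; linarith)
        have h3 : Real.exp (-r * T) ≤ 1 := Real.exp_le_one_iff.2 (by nlinarith)
        have h4 := ih (fun s => φ (T + s)) (T' - T) (hφ.shift hT'.1)
          (by
            simp only [add_zero]
            nlinarith [norm_nonneg (φ 0 - z)])
          (t - T) ⟨by linarith, by linarith [ht.2]⟩ (by push_cast at htn; linarith)
        simp only [add_zero, add_sub_cancel] at h4
        calc ‖φ t - z‖ ≤ k * ‖φ T - z‖ * Real.exp (-r * (t - T)) := h4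
          _ ≤ k * (Real.exp (-r * T) * ‖φ 0 - z‖) * Real.exp (-r * (t - T)) := by gcongr
          _ = k * ‖φ 0 - z‖ * (Real.exp (-r * T) * Real.exp (-r * (t - T))) := by ring
          _ = _ := by rw [← Real.exp_add]; ring_nf
  refine ⟨δ, hδ, k, hk0, fun φ T' hφ h0 t ht => ?_⟩
  obtain ⟨n, hn⟩ := exists_nat_gt (t / T)
  exact main n φ T' hφ h0 t ht (by rwa [div_lt_iff₀ (by linarith)] at hn)

lemma HasExponentialRate.mono {r s : ℝ} (h : HasExponentialRate v z s) (hrs : r ≤ s) :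
    HasExponentialRate v z r := by
  obtain ⟨δ, hδ, k, hk, h⟩ := h
  refine ⟨δ, hδ, k, hk, fun φ T hφ h0 t ht => (h φ T hφ h0 t ht).trans ?_⟩
  have := ht.1
  gcongr

lemma HasExponentialRate.isStable {r : ℝ} (h : HasExponentialRate v z r) (hr : 0 ≤ r) :
    IsStable v z := by
  obtain ⟨δ, hδ, k, hk, h⟩ := h
  intro ε hε
  refine ⟨min δ (ε / k), by positivity, fun φ T hφ h0 t ht => ?_⟩
  have h1 := h φ T hφ (h0.trans_le (min_le_left _ _)) t ht
  have h2 : k * ‖φ 0 - z‖ < ε := by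
    rw [mul_comm, ← lt_div_iff₀ hk]
    exact h0.trans_le (min_le_right _ _)
  have h3 : Real.exp (-r * t) ≤ 1 := Real.exp_le_one_iff.2 (by nlinarith [ht.1])
  exact (h1.trans (mul_le_of_le_one_right (by positivity) h3)).trans_lt h2

lemma HasExponentialRate.isAsymptoticallyStable {r : ℝ} (h : HasExponentialRate v z r)
    (hr : 0 < r) : IsAsymptoticallyStable v z := by
  refine ⟨h.isStable hr.le, ?_⟩
  obtain ⟨δ, hδ, k, hk, h⟩ := h
  refine ⟨δ, hδ, fun φ hφ h0 => ?_⟩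
  rw [tendsto_iff_norm_sub_tendsto_zero]
  have hlim : Tendsto (fun t : ℝ => k * ‖φ 0 - z‖ * Real.exp (-r * t)) atTop (𝓝 0) := by
    have h1 : Tendsto (fun t : ℝ => Real.exp (-r * t)) atTop (𝓝 0) :=
      Real.tendsto_exp_atBot.comp (tendsto_id.const_mul_atTop_of_neg (by linarith))
    simpa using h1.const_mul (k * ‖φ 0 - z‖)
  refine squeeze_zero' (Eventually.of_forall fun _ => norm_nonneg _) ?_ hlim
  filter_upwards [eventually_ge_atTop 0] with t ht
  exact h φ (t + 1) (hφ.mono fun s hs => hs.1) h0 t ⟨ht, by linarith⟩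

/-- The radial retraction onto the closed ball of radius `R` about the origin. -/
def radialRetraction (R : ℝ) (x : W) : W := (R / max R ‖x‖) • x

lemma norm_radialRetraction_le {R : ℝ} (hR : 0 < R) (x : W) : ‖radialRetraction R x‖ ≤ R := by
  have h : 0 < max R ‖x‖ := lt_max_of_lt_left hR
  rw [radialRetraction, norm_smul, Real.norm_of_nonneg (by positivity), div_mul_eq_mul_div,
    div_le_iff₀ h]
  gcongr
  exact le_max_right _ _

lemma radialRetraction_of_norm_le {R : ℝ} (hR : 0 < R) {x : W} (hx : ‖x‖ ≤ R) :
    radialRetraction R x = x := by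
  rw [radialRetraction, max_eq_left hx, div_self hR.ne', one_smul]

lemma lipschitzWith_radialRetraction {R : ℝ} (hR : 0 < R) :
    LipschitzWith 2 (radialRetraction R : W → W) := by
  refine LipschitzWith.of_dist_le_mul fun x y => ?_
  rw [dist_eq_norm, dist_eq_norm]
  simp only [radialRetraction]
  set a := max R ‖x‖ with ha
  set b := max R ‖y‖ with hb
  have ha0 : 0 < a := lt_max_of_lt_left hR
  have hb0 : 0 < b := lt_max_of_lt_left hR
  have hab : |b - a| ≤ ‖x - y‖ := by
    rw [abs_sub_comm, ha, hb, max_comm R, max_comm R]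
    exact (abs_max_sub_max_le_abs _ _ _).trans (abs_norm_sub_norm_le x y)
  have e : (R / a) • x - (R / b) • y = (R / a) • (x - y) + (R / a * ((b - a) / b)) • y := by
    rw [smul_sub, sub_add, sub_right_inj, ← sub_smul]
    congr 1
    field_simp
    ring
  have hRa : R / a ≤ 1 := (div_le_one ha0).2 (le_max_left _ _)
  have hyb : ‖y‖ / b ≤ 1 := (div_le_one hb0).2 (le_max_right _ _)
  rw [e]
  refine (norm_add_le _ _).trans ?_
  rw [norm_smul, norm_smul, Real.norm_of_nonneg (by positivity : 0 ≤ R / a), Real.norm_eq_abs,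
    abs_mul, abs_of_nonneg (by positivity : 0 ≤ R / a), abs_div, abs_of_pos hb0]
  have h1 : R / a * ‖x - y‖ ≤ 1 * ‖x - y‖ := by gcongr
  have h2 : R / a * (|b - a| / b) * ‖y‖ ≤ 1 * ‖x - y‖ := by
    calc R / a * (|b - a| / b) * ‖y‖ = R / a * |b - a| * (‖y‖ / b) := by ring
      _ ≤ 1 * ‖x - y‖ * 1 := by gcongr
      _ = _ := by ring
  push_cast
  linarith

/-- A bounded Lipschitz field has solutions for all positive times: Picard–Lindelöf applies on every
interval `[0, N]`, and the solutions fit together by uniqueness. -/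
lemma exists_isSolutionOn_Ici_of_bounded [CompleteSpace W] {K : ℝ≥0} (hL : LipschitzWith K v)
    {C : ℝ} (hC : ∀ x, ‖v x‖ ≤ C) (w : W) :
    ∃ φ : ℝ → W, φ 0 = w ∧ IsSolutionOn v φ (Ici 0) := by
  have hC0 : 0 ≤ C := (norm_nonneg _).trans (hC w)
  have hex : ∀ N : ℕ, ∃ φ : ℝ → W, φ 0 = w ∧
      ∀ t ∈ Icc (0 : ℝ) N, HasDerivWithinAt φ (v (φ t)) (Icc 0 N) t := by
    intro N
    have h0 : (0 : ℝ) ∈ Icc (0 : ℝ) N := ⟨le_rfl, by positivity⟩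
    have hPL : IsPicardLindelof (fun _ => v) (⟨0, h0⟩ : Icc (0 : ℝ) N) w (C.toNNReal * N) 0
        C.toNNReal K :=
      IsPicardLindelof.of_time_independent (fun x _ => by simpa [hC0] using hC x)
        hL.lipschitzOnWith (by simp)
    exact hPL.exists_eq_forall_mem_Icc_hasDerivWithinAt₀
  choose φ hφ0 hφ using hex
  have hsol : ∀ N : ℕ, IsSolutionOn v (φ N) (Ico 0 N) := fun N t ht =>
    (hφ N t ⟨ht.1, ht.2.le⟩).mono Ico_subset_Icc_self
  have huniq : ∀ N N' : ℕ, N ≤ N' → ∀ t ∈ Ico (0 : ℝ) N, φ N t = φ N' t := by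
    intro N N' hNN' t ht
    have hN : (N : ℝ) ≤ N' := by exact_mod_cast hNN'
    exact ODE_solution_unique (v := fun _ => v) (fun _ => hL) (a := 0) (b := t)
      ((hsol N).continuousOn.mono fun s hs => ⟨hs.1, hs.2.trans_lt ht.2⟩)
      (fun s hs => (hsol N).hasDerivWithinAt_Ici ⟨hs.1, hs.2.trans ht.2⟩)
      ((hsol N').continuousOn.mono fun s hs => ⟨hs.1, (hs.2.trans_lt ht.2).trans_le hN⟩)
      (fun s hs => (hsol N').hasDerivWithinAt_Ici ⟨hs.1, (hs.2.trans ht.2).trans_le hN⟩)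
      ((hφ0 N).trans (hφ0 N').symm) ⟨ht.1, le_rfl⟩
  have hfl : ∀ t : ℝ, 0 ≤ t → t < ((⌊t⌋₊ + 1 : ℕ) : ℝ) := fun t _ => by
    push_cast; exact Nat.lt_floor_add_one t
  refine ⟨fun t => φ (⌊t⌋₊ + 1) t, by simpa using hφ0 1, fun t ht => ?_⟩
  set N := ⌊t⌋₊ + 1 with hN
  have heq : ∀ s ∈ Ico (0 : ℝ) N, φ (⌊s⌋₊ + 1) s = φ N s := by
    intro s hs
    refine huniq _ _ ?_ s ⟨hs.1, hfl s hs.1⟩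
    have := (Nat.floor_lt hs.1).2 hs.2
    omega
  have h1 : HasDerivWithinAt (φ N) (v (φ N t)) (Ici 0) t :=
    (hsol N t ⟨ht, hfl t ht⟩).mono_of_mem_nhdsWithin
      (by
        have : Ico (0 : ℝ) N = Ici 0 ∩ Iio (N : ℝ) := rfl
        rw [this]
        exact inter_mem_nhdsWithin _ (Iio_mem_nhds (hfl t ht)))
  refine h1.congr_of_eventuallyEq ?_ rfl
  filter_upwards [self_mem_nhdsWithin, mem_nhdsWithin_of_mem_nhds (Iio_mem_nhds (hfl t ht))]
    with s hs hs'
  exact heq s ⟨hs, hs'⟩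

/-- Solutions starting near a linearly stable equilibrium are global: a bounded Lipschitz field that
agrees with `v` near `z` has global solutions, and these never leave the region of agreement. -/
lemma hasForwardSolutionsNear_of_norm_exp_smul_le [CompleteSpace W] {K : ℝ≥0} {R : ℝ}
    {J : W →L[ℝ] W} (hz : v z = 0) (hR : 0 < R) (hL : LipschitzOnWith K v (Metric.closedBall z R))
    (hJ : HasFDerivAt v J z) {C r' : ℝ} (hr' : 0 < r')
    (hC : ∀ t : ℝ, 0 ≤ t → ‖exp (t • J)‖ ≤ C * Real.exp (-r' * t)) :
    HasForwardSolutionsNear v z := by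
  set ρ : W → W := fun x => z + radialRetraction R (x - z) with hρ
  have hρmem : ∀ x, ρ x ∈ Metric.closedBall z R := fun x => by
    simpa [hρ, dist_eq_norm] using norm_radialRetraction_le hR (x - z)
  have hρid : ∀ x ∈ Metric.closedBall z R, ρ x = x := fun x hx => by
    rw [Metric.mem_closedBall, dist_eq_norm] at hx
    simp [hρ, radialRetraction_of_norm_le hR hx]
  have hρL : LipschitzWith 2 ρ := LipschitzWith.of_dist_le_mul fun x y => by
    have := (lipschitzWith_radialRetraction hR).dist_le_mul (x - z) (y - z)
    simpa [hρ] using this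
  have hLw : LipschitzWith (K * 2) (v ∘ ρ) := by
    rw [← lipschitzOnWith_univ]
    exact hL.comp hρL.lipschitzOnWith fun x _ => hρmem x
  have hbdd : ∀ x, ‖(v ∘ ρ) x‖ ≤ K * R := fun x => by
    have h1 := hL.dist_le_mul _ (hρmem x) _ (Metric.mem_closedBall_self hR.le)
    rw [hz, dist_zero_right] at h1
    refine h1.trans ?_
    gcongr
    exact hρmem x
  have hJw : HasFDerivAt (v ∘ ρ) J z := by
    refine hJ.congr_of_eventuallyEq ?_
    filter_upwards [Metric.closedBall_mem_nhds z hR] with x hx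
    simp [hρid x hx]
  have hzw : (v ∘ ρ) z = 0 := by simp [hρid z (Metric.mem_closedBall_self hR.le), hz]
  obtain ⟨δ, hδ, hst⟩ := (hasExponentialRate_of_norm_exp_smul_le hzw hR hLw.lipschitzOnWith hJw
    le_rfl hr' hC).isStable le_rfl R hR
  refine ⟨δ, hδ, fun w hw => ?_⟩
  obtain ⟨φ, hφ0, hφ⟩ := exists_isSolutionOn_Ici_of_bounded hLw hbdd w
  refine ⟨φ, hφ0, fun t ht => ?_⟩
  have h1 := hst φ (t + 1) (hφ.mono fun s hs => hs.1) (by rwa [hφ0]) t ⟨ht, by linarith⟩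
  have h2 := hφ t ht
  rwa [Function.comp_apply, hρid _ (by rw [Metric.mem_closedBall, dist_eq_norm]; exact h1.le)] at h2

/-- Conversely, every exponential rate of the nonlinear flow is one of the linearized flow. -/
lemma HasExponentialRate.exists_norm_exp_smul_le [CompleteSpace W] {K : ℝ≥0} {R : ℝ}
    {J : W →L[ℝ] W} (hz : v z = 0) (hR : 0 < R) (hL : LipschitzOnWith K v (Metric.closedBall z R))
    (hJ : HasFDerivAt v J z) (hfwd : HasForwardSolutionsNear v z) {r : ℝ}
    (hr : HasExponentialRate v z r) :
    ∃ k, ∀ t : ℝ, 0 ≤ t → ‖exp (t • J)‖ ≤ k * Real.exp (-r * t) := by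
  obtain ⟨δ₁, hδ₁, hfwd⟩ := hfwd
  obtain ⟨δ₂, hδ₂, k, hk, hr⟩ := hr
  refine ⟨k, fun t ht => ContinuousLinearMap.opNorm_le_bound _ (by positivity) fun w => ?_⟩
  refine le_of_forall_pos_le_add fun ε hε => ?_
  obtain ⟨δ₃, hδ₃, hcmp⟩ := exists_norm_sub_exp_smul_le hz hR hL hJ (T := t)
    (ε := ε / (‖w‖ + 1)) ht (by positivity)
  -- by linearity of `exp (t J)`, the estimate at `w` follows from that at a small multiple `s w`
  set s := min δ₁ (min δ₂ δ₃) / (‖w‖ + 1) with hs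
  have hs0 : 0 < s := by positivity
  have hsw : ‖s • w‖ < min δ₁ (min δ₂ δ₃) := by
    rw [norm_smul, Real.norm_of_nonneg hs0.le, hs, div_mul_eq_mul_div, div_lt_iff₀ (by positivity)]
    gcongr
    linarith
  obtain ⟨φ, hφ0, hφ⟩ := hfwd (z + s • w) (by simpa using hsw.trans_le (min_le_left _ _))
  have hφw : φ 0 - z = s • w := by simp [hφ0]
  have hφ' : IsSolutionOn v φ (Ico 0 (t + 1)) := hφ.mono fun u hu => hu.1
  have ht' : t ∈ Ico 0 (t + 1) := ⟨ht, by linarith⟩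
  have h1 := hr φ _ hφ' (by
    rw [hφw]; exact hsw.trans_le ((min_le_right _ _).trans (min_le_left _ _))) t ht'
  have h2 := hcmp φ _ hφ' (by
    rw [hφw]; exact hsw.trans_le ((min_le_right _ _).trans (min_le_right _ _))) t ht' le_rfl
  rw [hφw] at h1 h2
  have h3 : ‖exp (t • J) (s • w)‖ ≤
      k * ‖s • w‖ * Real.exp (-r * t) + ε / (‖w‖ + 1) * ‖s • w‖ := by
    have := norm_sub_norm_le (exp (t • J) (s • w)) (φ t - z)
    rw [norm_sub_rev (exp (t • J) (s • w))] at this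
    linarith
  rw [map_smul, norm_smul, norm_smul, Real.norm_of_nonneg hs0.le] at h3
  have h4 : s * ‖exp (t • J) w‖ ≤
      s * (k * Real.exp (-r * t) * ‖w‖ + ε / (‖w‖ + 1) * ‖w‖) := by linarith
  have h5 := le_of_mul_le_mul_left h4 hs0
  have h6 : ε / (‖w‖ + 1) * ‖w‖ ≤ ε := by
    rw [div_mul_eq_mul_div, div_le_iff₀ (by positivity)]
    nlinarith
  linarith

end LinearizedStability

/-! ### Growth of matrix exponentials -/

section ExponentialGrowth

open NormedSpace (exp)

section Complex

variable {F : Type*} [NormedAddCommGroup F] [NormedSpace ℂ F] [CompleteSpace F]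

lemma exp_smul_apply_of_pow_apply_eq_zero (N : F →L[ℂ] F) {x : F} {k : ℕ} (hk : (N ^ k) x = 0)
    (t : ℂ) : exp (t • N) x = ∑ n ∈ Finset.range k, ((n.factorial : ℂ)⁻¹ * t ^ n) • (N ^ n) x := by
  have h := (NormedSpace.exp_series_hasSum_exp' (𝕂 := ℂ) (t • N)).mapL
    (ContinuousLinearMap.apply ℂ F x)
  simp only [ContinuousLinearMap.apply_apply, _root_.smul_apply, smul_pow,
    smul_smul] at h
  refine h.unique (hasSum_sum_of_ne_finset_zero fun n hn => ?_)
  have hkn : k ≤ n := by simpa using hn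
  have : (N ^ n) x = 0 := by
    rw [← Nat.sub_add_cancel hkn, pow_add, mul_apply_eq_comp, hk, map_zero]
  rw [this, smul_zero]

lemma exp_smul_eq_smul_exp_smul_sub (A : F →L[ℂ] F) (c t : ℂ) :
    exp (t • A) = Complex.exp (t * c) • exp (t • (A - c • (1 : F →L[ℂ] F))) := by
  let _ : NormedAlgebra ℚ (F →L[ℂ] F) := NormedAlgebra.restrictScalars ℚ ℂ _
  have h1 : t • A = algebraMap ℂ (F →L[ℂ] F) (t * c) + t • (A - c • (1 : F →L[ℂ] F)) := by
    rw [Algebra.algebraMap_eq_smul_one, smul_sub, smul_smul]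
    abel
  have h2 : exp (algebraMap ℂ (F →L[ℂ] F) (t * c)) =
      algebraMap ℂ (F →L[ℂ] F) (Complex.exp (t * c)) := by
    rw [Complex.exp_eq_exp_ℂ, NormedSpace.algebraMap_exp_comm]
  rw [h1, NormedSpace.exp_add_of_commute (Algebra.commutes _ _), h2,
    ← Algebra.smul_def]

/-- On a generalized eigenvector, the exponential is `exp (t c)` times a polynomial in `t`. -/
lemma exists_norm_exp_smul_apply_le (A : F →L[ℂ] F) {c : ℂ} {r : ℝ} (hc : c.re < -r) {x : F}
    {k : ℕ} (hk : ((A - c • (1 : F →L[ℂ] F)) ^ k) x = 0) :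
    ∃ C, ∀ t : ℝ, 0 ≤ t → ‖exp ((t : ℂ) • A) x‖ ≤ C * Real.exp (-r * t) := by
  set N := A - c • (1 : F →L[ℂ] F) with hN
  set a := -r - c.re with ha
  have ha0 : 0 < a := by linarith
  refine ⟨∑ n ∈ Finset.range k, ‖(N ^ n) x‖ / a ^ n, fun t ht => ?_⟩
  rw [exp_smul_eq_smul_exp_smul_sub A c, _root_.smul_apply, ← hN,
    exp_smul_apply_of_pow_apply_eq_zero N hk, norm_smul, Complex.norm_exp, Complex.re_ofReal_mul]
  refine (mul_le_mul_of_nonneg_left (norm_sum_le _ _) (Real.exp_pos _).le).trans ?_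
  rw [Finset.mul_sum, Finset.sum_mul]
  refine Finset.sum_le_sum fun n _ => ?_
  have h1 : t ^ n / n.factorial ≤ Real.exp (a * t) / a ^ n := by
    have := Real.pow_div_factorial_le_exp (a * t) (by positivity) n
    rw [mul_pow] at this
    rw [le_div_iff₀ (by positivity)]
    calc _ = a ^ n * t ^ n / n.factorial := by ring
      _ ≤ _ := this
  have h2 : ‖((n.factorial : ℂ)⁻¹ * (t : ℂ) ^ n)‖ = t ^ n / n.factorial := by
    rw [norm_mul, norm_inv, norm_pow, Complex.norm_natCast, Complex.norm_real,
      Real.norm_of_nonneg ht]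
    ring
  rw [norm_smul, h2]
  calc Real.exp (t * c.re) * (t ^ n / n.factorial * ‖(N ^ n) x‖)
      ≤ Real.exp (t * c.re) * (Real.exp (a * t) / a ^ n * ‖(N ^ n) x‖) := by gcongr
    _ = ‖(N ^ n) x‖ / a ^ n * (Real.exp (t * c.re) * Real.exp (a * t)) := by ring
    _ = _ := by rw [← Real.exp_add, ha]; ring_nf

lemma exists_norm_exp_smul_le_of_eigenvalues [FiniteDimensional ℂ F] (A : F →L[ℂ] F) {r : ℝ}
    (hA : ∀ c : ℂ, Module.End.HasEigenvalue (A : F →ₗ[ℂ] F) c → c.re < -r) :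
    ∃ C, ∀ t : ℝ, 0 ≤ t → ‖exp ((t : ℂ) • A)‖ ≤ C * Real.exp (-r * t) := by
  -- powers may be taken before or after forgetting continuity
  have hcoe : ∀ (B : F →L[ℂ] F) (k : ℕ) (x : F), ((B : F →ₗ[ℂ] F) ^ k) x = (B ^ k) x := by
    intro B k
    induction k with
    | zero => intro x; simp
    | succ k ih => intro x; rw [pow_succ, pow_succ]; simp [ih]
  have hpt : ∀ x : F, ∃ C, ∀ t : ℝ, 0 ≤ t → ‖exp ((t : ℂ) • A) x‖ ≤ C * Real.exp (-r * t) := by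
    intro x
    have hx : x ∈ ⨆ c : ℂ, Module.End.maxGenEigenspace (A : F →ₗ[ℂ] F) c := by
      rw [Module.End.iSup_maxGenEigenspace_eq_top]; trivial
    induction hx using Submodule.iSup_induction' with
    | zero => exact ⟨0, fun t _ => by simp⟩
    | add x y _ _ hx hy =>
      obtain ⟨C, hC⟩ := hx
      obtain ⟨D, hD⟩ := hy
      refine ⟨C + D, fun t ht => ?_⟩
      rw [map_add, add_mul]
      exact (norm_add_le _ _).trans (add_le_add (hC t ht) (hD t ht))
    | mem c x hx =>
      obtain ⟨k, hk⟩ := (Module.End.mem_maxGenEigenspace _ _ _).1 hx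
      by_cases hc : Module.End.HasEigenvalue (A : F →ₗ[ℂ] F) c
      · refine exists_norm_exp_smul_apply_le A (hA c hc) (k := k) ?_
        rw [← hcoe]
        exact hk
      · -- away from the spectrum, the generalized eigenspace is trivial
        have hker : LinearMap.ker ((A : F →ₗ[ℂ] F) - c • 1) = ⊥ := by
          rw [← Module.End.eigenspace_def]
          exact not_not.1 hc
        have hinj := LinearMap.ker_eq_bot.1 hker
        have hinjk : Function.Injective ⇑((((A : F →ₗ[ℂ] F) - c • 1) : Module.End ℂ F) ^ k) := by
          rw [Module.End.coe_pow]
          exact hinj.iterate k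
        have hx0 : x = 0 := hinjk (by rw [hk, map_zero])
        exact ⟨0, fun t _ => by simp [hx0]⟩
  -- the pointwise bounds are uniform by Banach–Steinhaus
  obtain ⟨C, hC⟩ := banach_steinhaus
    (g := fun t : Ici (0 : ℝ) => (Real.exp (r * t) : ℂ) • exp (((t : ℝ) : ℂ) • A)) (fun x => by
      obtain ⟨C, hC⟩ := hpt x
      refine ⟨C, fun t => ?_⟩
      rw [_root_.smul_apply, norm_smul, Complex.norm_real,
        Real.norm_of_nonneg (Real.exp_pos _).le]
      refine (mul_le_mul_of_nonneg_left (hC t t.2) (Real.exp_pos _).le).trans_eq ?_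
      rw [mul_left_comm, ← Real.exp_add]
      simp)
  refine ⟨C, fun t ht => ?_⟩
  have := hC ⟨t, ht⟩
  rw [norm_smul, Complex.norm_real, Real.norm_of_nonneg (Real.exp_pos _).le] at this
  calc ‖exp ((t : ℂ) • A)‖ = (Real.exp (r * t) * ‖exp ((t : ℂ) • A)‖) * Real.exp (-r * t) := by
        rw [mul_right_comm, ← Real.exp_add]; simp
    _ ≤ _ := by gcongr

lemma le_neg_re_of_norm_exp_smul_le (A : F →L[ℂ] F) {r C : ℝ}
    (hC : ∀ t : ℝ, 0 ≤ t → ‖exp ((t : ℂ) • A)‖ ≤ C * Real.exp (-r * t)) {c : ℂ}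
    (hc : Module.End.HasEigenvalue (A : F →ₗ[ℂ] F) c) : r ≤ -c.re := by
  obtain ⟨x, hx⟩ := hc.exists_hasEigenvector
  have hAx : A x = c • x := hx.apply_eq_smul
  have hx0 : 0 < ‖x‖ := norm_pos_iff.2 hx.2
  have hexp : ∀ t : ℝ, 0 ≤ t → Real.exp ((c.re + r) * t) ≤ C := by
    intro t ht
    have h1 : exp ((t : ℂ) • A) x = Complex.exp (t * c) • x := by
      rw [exp_smul_eq_smul_exp_smul_sub A c, _root_.smul_apply,
        exp_smul_apply_of_pow_apply_eq_zero (k := 1) _ (by simp [hAx])]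
      simp
    have h2 := ((exp ((t : ℂ) • A)).le_opNorm x).trans
      (mul_le_mul_of_nonneg_right (hC t ht) hx0.le)
    rw [h1, norm_smul, Complex.norm_exp, Complex.re_ofReal_mul] at h2
    have h3 := le_of_mul_le_mul_right h2 hx0
    calc Real.exp ((c.re + r) * t) = Real.exp (t * c.re) * Real.exp (r * t) := by
          rw [← Real.exp_add]; ring_nf
      _ ≤ C * Real.exp (-r * t) * Real.exp (r * t) := by gcongr
      _ = C := by rw [mul_assoc, ← Real.exp_add]; simp
  by_contra! hlt
  obtain ⟨t, ht, ht0⟩ := (((Real.tendsto_exp_atTop.comp (tendsto_id.const_mul_atTop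
    (by linarith : 0 < c.re + r))).eventually_gt_atTop C).and (eventually_ge_atTop 0)).exists
  exact absurd (hexp t ht0) (not_le.2 ht)

end Complex

variable {W ι : Type*} [NormedAddCommGroup W] [NormedSpace ℝ W] [FiniteDimensional ℝ W]
  [Fintype ι] [DecidableEq ι]

/-- Complexification of operators on a real space with a basis, as a homomorphism of real
algebras: an operator is sent to the action of its matrix on complex vectors. -/
def complexify (b : Module.Basis ι ℝ W) : (W →L[ℝ] W) →ₐ[ℝ] ((ι → ℂ) →L[ℂ] (ι → ℂ)) :=
  ((Module.End.toContinuousLinearMap (ι → ℂ)).toAlgHom.restrictScalars ℝ).comp <|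
    ((Matrix.toLinAlgEquiv' (R := ℂ) (n := ι)).toAlgHom.restrictScalars ℝ).comp <|
      (AlgHom.mapMatrix Complex.ofRealAm).comp <|
        (LinearMap.toMatrixAlgEquiv b).toAlgHom.comp
          (Module.End.toContinuousLinearMap W).symm.toAlgHom

lemma coe_complexify (b : Module.Basis ι ℝ W) (J : W →L[ℝ] W) :
    (complexify b J : (ι → ℂ) →ₗ[ℂ] (ι → ℂ)) =
      Matrix.toLin' ((LinearMap.toMatrix b b (J : W →ₗ[ℝ] W)).map ((↑) : ℝ → ℂ)) := rfl

lemma complexify_injective (b : Module.Basis ι ℝ W) : Function.Injective (complexify b) := by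
  intro J J' h
  have h1 := congrArg (fun A : (ι → ℂ) →L[ℂ] (ι → ℂ) => (A : (ι → ℂ) →ₗ[ℂ] (ι → ℂ))) h
  simp only [coe_complexify] at h1
  have h2 := Matrix.map_injective Complex.ofReal_injective (Matrix.toLin'.injective h1)
  exact ContinuousLinearMap.coe_injective ((LinearMap.toMatrix b b).injective h2)

lemma complexify_exp_smul (b : Module.Basis ι ℝ W) (J : W →L[ℝ] W) (t : ℝ) :
    complexify b (exp (t • J)) = exp ((t : ℂ) • complexify b J) := by
  let _ : NormedAlgebra ℚ (W →L[ℝ] W) := NormedAlgebra.restrictScalars ℚ ℝ _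
  let _ : NormedAlgebra ℚ ((ι → ℂ) →L[ℂ] (ι → ℂ)) := NormedAlgebra.restrictScalars ℚ ℂ _
  have hcont : Continuous (complexify b) :=
    (complexify b).toLinearMap.continuous_of_finiteDimensional
  rw [NormedSpace.map_exp (complexify b) hcont, map_smul]
  rfl

lemma exists_norm_exp_smul_le_of_eigenvalueSet (b : Module.Basis ι ℝ W) (J : W →L[ℝ] W) {r : ℝ}
    (hJ : ∀ c ∈ eigenvalueSet
      ((LinearMap.toMatrix b b (J : W →ₗ[ℝ] W)).map ((↑) : ℝ → ℂ)), c.re < -r) :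
    ∃ C, ∀ t : ℝ, 0 ≤ t → ‖exp (t • J)‖ ≤ C * Real.exp (-r * t) := by
  obtain ⟨C, hC⟩ := exists_norm_exp_smul_le_of_eigenvalues (complexify b J) (r := r)
    (fun c hc => hJ c (by rwa [coe_complexify] at hc))
  obtain ⟨K, hK, hanti⟩ := (complexify b).toLinearMap.exists_antilipschitzWith
    (LinearMap.ker_eq_bot.2 (complexify_injective b))
  refine ⟨K * C, fun t ht => ?_⟩
  have h1 := hanti.le_mul_norm (map_zero _) (exp (t • J))
  rw [AlgHom.toLinearMap_apply, complexify_exp_smul] at h1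
  rw [mul_assoc]
  exact h1.trans (by gcongr; exact hC t ht)

lemma le_neg_re_of_mem_eigenvalueSet (b : Module.Basis ι ℝ W) (J : W →L[ℝ] W) {r C : ℝ}
    (hC : ∀ t : ℝ, 0 ≤ t → ‖exp (t • J)‖ ≤ C * Real.exp (-r * t)) {c : ℂ}
    (hc : c ∈ eigenvalueSet ((LinearMap.toMatrix b b (J : W →ₗ[ℝ] W)).map ((↑) : ℝ → ℂ))) :
    r ≤ -c.re := by
  set Ψ := LinearMap.toContinuousLinearMap (complexify b).toLinearMap with hΨ
  refine le_neg_re_of_norm_exp_smul_le (complexify b J) (C := ‖Ψ‖ * C) (fun t ht => ?_)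
    (by rw [coe_complexify]; exact hc)
  rw [← complexify_exp_smul, mul_assoc]
  exact (Ψ.le_opNorm _).trans (by gcongr; exact hC t ht)

end ExponentialGrowth

/-! ### Stability and the spectrum of the linearization -/

section SpectralStability

open scoped NNReal

variable {W ι : Type*} [NormedAddCommGroup W] [NormedSpace ℝ W] [FiniteDimensional ℝ W]
  [Fintype ι] [DecidableEq ι]

lemma finite_eigenvalueSet {𝕜 : Type*} [Field 𝕜] (A : Matrix ι ι 𝕜) : (eigenvalueSet A).Finite :=
  Module.End.finite_hasEigenvalue _

lemma exists_gt_forall_mem_eigenvalueSet (A : Matrix ι ι ℂ) {r : ℝ}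
    (hr : ∀ c ∈ eigenvalueSet A, r < -c.re) : ∃ r' > r, ∀ c ∈ eigenvalueSet A, r' < -c.re := by
  have h1 : ∀ᶠ r' in 𝓝[>] r, ∀ c ∈ eigenvalueSet A, r' < -c.re :=
    (eventually_all_finite (finite_eigenvalueSet A)).2 fun c hc =>
      mem_nhdsWithin_of_mem_nhds (Iio_mem_nhds (hr c hc))
  obtain ⟨r', h2, h3⟩ := (h1.and self_mem_nhdsWithin).exists
  exact ⟨r', h3, h2⟩

/-- Lyapunov's indirect method, with the exact range of exponential rates. -/
theorem isExponentiallyStable_of_eigenvalueSet (b : Module.Basis ι ℝ W) {v : W → W} {z : W}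
    {K : ℝ≥0} {R : ℝ} {J : W →L[ℝ] W} (hz : v z = 0) (hR : 0 < R)
    (hL : LipschitzOnWith K v (Metric.closedBall z R)) (hJ : HasFDerivAt v J z)
    (hneg : ∀ c ∈ eigenvalueSet
      ((LinearMap.toMatrix b b (J : W →ₗ[ℝ] W)).map ((↑) : ℝ → ℂ)), c.re < 0) :
    IsExponentiallyStable v z ∧
    (∀ r : ℝ, (∀ c ∈ eigenvalueSet
      ((LinearMap.toMatrix b b (J : W →ₗ[ℝ] W)).map ((↑) : ℝ → ℂ)), r < -c.re) →
        HasExponentialRate v z r) ∧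
    (∀ r : ℝ, HasExponentialRate v z r → ∀ c ∈ eigenvalueSet
      ((LinearMap.toMatrix b b (J : W →ₗ[ℝ] W)).map ((↑) : ℝ → ℂ)), r ≤ -c.re) := by
  have : CompleteSpace W := FiniteDimensional.complete ℝ W
  set S := eigenvalueSet ((LinearMap.toMatrix b b (J : W →ₗ[ℝ] W)).map ((↑) : ℝ → ℂ)) with hS
  have hneg' : ∀ c ∈ S, 0 < -c.re := fun c hc => neg_pos.2 (hneg c hc)
  have hrate : ∀ r : ℝ, (∀ c ∈ S, r < -c.re) → HasExponentialRate v z r := by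
    intro r hr
    obtain ⟨r', hr', hc⟩ := exists_gt_forall_mem_eigenvalueSet _
      (r := max r 0) (fun c hc => max_lt (hr c hc) (hneg' c hc))
    obtain ⟨C, hC⟩ := exists_norm_exp_smul_le_of_eigenvalueSet b J (r := r')
      (fun c hc' => by linarith [hc c hc'])
    exact (hasExponentialRate_of_norm_exp_smul_le hz hR hL hJ (le_max_right _ _) hr' hC).mono
      (le_max_left _ _)
  obtain ⟨r, hr0, hr⟩ := exists_gt_forall_mem_eigenvalueSet _ hneg'
  obtain ⟨C, hC⟩ := exists_norm_exp_smul_le_of_eigenvalueSet b J (r := r)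
    (fun c hc' => by linarith [hr c hc'])
  have hfwd : HasForwardSolutionsNear v z :=
    hasForwardSolutionsNear_of_norm_exp_smul_le hz hR hL hJ hr0 hC
  refine ⟨⟨hz, hfwd, (hrate r hr).isAsymptoticallyStable hr0, r, hr0, hrate r hr⟩, hrate,
    fun s hs c hc => ?_⟩
  obtain ⟨k, hk⟩ := hs.exists_norm_exp_smul_le hz hR hL hJ hfwd
  exact le_neg_re_of_mem_eigenvalueSet b J hk hc

end SpectralStability

/-! ### Eigenvalue bounds -/

section EigenvalueBounds

open Matrix

section Symmetric

variable {d : ℕ} {S : Matrix (Fin d) (Fin d) ℝ}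

lemma mem_eigenvalueSet_iff {𝕜 ι : Type*} [Field 𝕜] [Fintype ι] [DecidableEq ι]
    {A : Matrix ι ι 𝕜} {c : 𝕜} : c ∈ eigenvalueSet A ↔ ∃ x ≠ 0, A *ᵥ x = c • x := by
  constructor
  · intro h
    obtain ⟨x, hx⟩ := Module.End.HasEigenvalue.exists_hasEigenvector h
    exact ⟨x, hx.2, by simpa using hx.apply_eq_smul⟩
  · rintro ⟨x, hx, h⟩
    exact Module.End.hasEigenvalue_of_hasEigenvector
      ⟨Module.End.mem_eigenspace_iff.2 (by simpa using h), hx⟩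

lemma Matrix.IsHermitian.eigenvalueSet_nonempty (hS : S.IsHermitian) (hd : 0 < d) :
    (eigenvalueSet S).Nonempty := by
  refine ⟨hS.eigenvalues ⟨0, hd⟩, mem_eigenvalueSet_iff.2
    ⟨⇑(hS.eigenvectorBasis ⟨0, hd⟩), fun h => ?_, hS.mulVec_eigenvectorBasis _⟩⟩
  have := hS.eigenvectorBasis.orthonormal.ne_zero ⟨0, hd⟩
  exact this (by ext i; exact congrFun h i)

lemma posSemidef_of_eigenvalueSet_nonneg (hS : S.IsHermitian)
    (h : ∀ c ∈ eigenvalueSet S, 0 ≤ c) : S.PosSemidef := by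
  refine hS.posSemidef_iff_eigenvalues_nonneg.2 fun i => h _ (mem_eigenvalueSet_iff.2
    ⟨⇑(hS.eigenvectorBasis i), fun h => ?_, hS.mulVec_eigenvectorBasis _⟩)
  have := hS.eigenvectorBasis.orthonormal.ne_zero i
  exact this (by ext j; exact congrFun h j)

lemma eigMin_mem (hS : S.IsHermitian) (hd : 0 < d) : eigMin S ∈ eigenvalueSet S :=
  (hS.eigenvalueSet_nonempty hd).csInf_mem (finite_eigenvalueSet S)

lemma eigMin_le_eigMax (hS : S.IsHermitian) (hd : 0 < d) : eigMin S ≤ eigMax S :=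
  le_csSup (finite_eigenvalueSet S).bddAbove (eigMin_mem hS hd)

lemma eigMin_mul_le (hS : S.IsHermitian) (x : Fin d → ℝ) :
    eigMin S * (x ⬝ᵥ x) ≤ x ⬝ᵥ S *ᵥ x := by
  have hH : (S - eigMin S • (1 : Matrix (Fin d) (Fin d) ℝ)).IsHermitian :=
    hS.sub (by simp [Matrix.IsHermitian])
  have h := (posSemidef_of_eigenvalueSet_nonneg hH fun c hc => by
    obtain ⟨y, hy, hcy⟩ := mem_eigenvalueSet_iff.1 hc
    have h1 : c + eigMin S ∈ eigenvalueSet S := mem_eigenvalueSet_iff.2 ⟨y, hy, by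
      rw [sub_mulVec, smul_mulVec, one_mulVec, sub_eq_iff_eq_add] at hcy
      rw [hcy, add_smul]⟩
    have := csInf_le (finite_eigenvalueSet S).bddBelow h1
    change eigMin S ≤ _ at this
    linarith).dotProduct_mulVec_nonneg x
  simp only [star_trivial, sub_mulVec, smul_mulVec, one_mulVec, dotProduct_sub, dotProduct_smul,
    smul_eq_mul] at h
  linarith

lemma le_eigMax_mul (hS : S.IsHermitian) (x : Fin d → ℝ) :
    x ⬝ᵥ S *ᵥ x ≤ eigMax S * (x ⬝ᵥ x) := by
  have hH : (eigMax S • (1 : Matrix (Fin d) (Fin d) ℝ) - S).IsHermitian :=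
    Matrix.IsHermitian.sub (by simp [Matrix.IsHermitian]) hS
  have h := (posSemidef_of_eigenvalueSet_nonneg hH fun c hc => by
    obtain ⟨y, hy, hcy⟩ := mem_eigenvalueSet_iff.1 hc
    have h1 : eigMax S - c ∈ eigenvalueSet S := mem_eigenvalueSet_iff.2 ⟨y, hy, by
      rw [sub_mulVec, smul_mulVec, one_mulVec, sub_eq_iff_eq_add] at hcy
      rw [sub_smul, hcy]; abel⟩
    have := le_csSup (finite_eigenvalueSet S).bddAbove h1
    change _ ≤ eigMax S at this
    linarith).dotProduct_mulVec_nonneg x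
  simp only [star_trivial, sub_mulVec, smul_mulVec, one_mulVec, dotProduct_sub, dotProduct_smul,
    smul_eq_mul] at h
  linarith

lemma eigMin_nonneg (hS : S.PosSemidef) (hd : 0 < d) : 0 ≤ eigMin S := by
  obtain ⟨x, hx, h⟩ := mem_eigenvalueSet_iff.1 (eigMin_mem hS.1 hd)
  have h1 := hS.dotProduct_mulVec_nonneg x
  rw [h, star_trivial, dotProduct_smul, smul_eq_mul] at h1
  have h2 : 0 < x ⬝ᵥ x := by simpa using dotProduct_star_self_pos_iff.2 hx
  exact nonneg_of_mul_nonneg_left h1 h2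

lemma eigMin_pos (hS : S.PosSemidef) (hd : 0 < d) (hinj : ∀ x, S *ᵥ x = 0 → x = 0) :
    0 < eigMin S := by
  refine lt_of_le_of_ne (eigMin_nonneg hS hd) fun h0 => ?_
  obtain ⟨x, hx, h⟩ := mem_eigenvalueSet_iff.1 (eigMin_mem hS.1 hd)
  exact hx (hinj x (by rw [h, ← h0, zero_smul]))

lemma FullColumnRank.eq_zero_of_mulVec_eq_zero {k d : ℕ} {Q : Matrix (Fin k) (Fin d) ℝ}
    (hQ : FullColumnRank Q) {x : Fin d → ℝ} (hx : Q *ᵥ x = 0) : x = 0 := by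
  have h1 := Q.mulVecLin.finrank_range_add_finrank_ker
  have h2 : Module.finrank ℝ (LinearMap.range Q.mulVecLin) = d := hQ
  rw [h2, Module.finrank_fin_fun] at h1
  have h3 : LinearMap.ker Q.mulVecLin = ⊥ := Submodule.finrank_eq_zero.1 (by omega)
  have h4 : x ∈ LinearMap.ker Q.mulVecLin := by simpa using hx
  simpa [h3] using h4

end Symmetric

variable {m n : ℕ} {P : Matrix (Fin m) (Fin m) ℝ} {Q : Matrix (Fin m) (Fin n) ℝ}
  {R : Matrix (Fin n) (Fin n) ℝ}

lemma real_dotProduct_self_nonneg {d : ℕ} (x : Fin d → ℝ) : 0 ≤ x ⬝ᵥ x := by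
  simpa using dotProduct_star_self_nonneg x

/-- For a positive semidefinite `S ≤ μ` one has `S ^ 2 ≤ μ S`. -/
lemma dotProduct_mulVec_self_le {S : Matrix (Fin n) (Fin n) ℝ} (hS : S.IsHermitian) {μ : ℝ}
    (hμ : 0 < μ) (h0 : ∀ y, 0 ≤ y ⬝ᵥ S *ᵥ y) (h1 : ∀ y, y ⬝ᵥ S *ᵥ y ≤ μ * (y ⬝ᵥ y))
    (y : Fin n → ℝ) : (S *ᵥ y) ⬝ᵥ (S *ᵥ y) ≤ μ * (y ⬝ᵥ S *ᵥ y) := by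
  -- the form `S` is nonnegative at `y - μ⁻¹ S y`
  have hsym : ∀ a b : Fin n → ℝ, a ⬝ᵥ S *ᵥ b = (S *ᵥ a) ⬝ᵥ b := fun a b => by
    have hT : Sᵀ = S := by simpa using hS.eq
    rw [dotProduct_mulVec, ← mulVec_transpose, hT]
  have h2 := h0 (y - μ⁻¹ • S *ᵥ y)
  have h3 := h1 (S *ᵥ y)
  have h4 : (y - μ⁻¹ • S *ᵥ y) ⬝ᵥ S *ᵥ (y - μ⁻¹ • S *ᵥ y) =
      y ⬝ᵥ S *ᵥ y - 2 * μ⁻¹ * ((S *ᵥ y) ⬝ᵥ (S *ᵥ y)) +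
        μ⁻¹ ^ 2 * ((S *ᵥ y) ⬝ᵥ S *ᵥ (S *ᵥ y)) := by
    simp only [mulVec_sub, mulVec_smul, sub_dotProduct, dotProduct_sub, smul_dotProduct,
      dotProduct_smul, smul_eq_mul, hsym y (S *ᵥ y)]
    ring
  rw [h4] at h2
  have h5 : μ⁻¹ ^ 2 * ((S *ᵥ y) ⬝ᵥ S *ᵥ (S *ᵥ y)) ≤ μ⁻¹ * ((S *ᵥ y) ⬝ᵥ (S *ᵥ y)) := by
    calc _ ≤ μ⁻¹ ^ 2 * (μ * ((S *ᵥ y) ⬝ᵥ (S *ᵥ y))) := by gcongr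
      _ = _ := by field_simp
  have h6 : μ⁻¹ * ((S *ᵥ y) ⬝ᵥ (S *ᵥ y)) ≤ y ⬝ᵥ S *ᵥ y := by linarith
  rwa [inv_mul_le_iff₀ hμ] at h6

/-- The bound on a real eigenvalue `c` of the saddle-point matrix with blocks `-P, Q, -Qᵀ, -R`.
If `c` were larger, `R + c` would be positive definite, and eliminating `y` from the eigenvector
equations would give `c (Λ + c) ≤ -σ` for the bounds `Λ` and `σ` of the blocks. -/
lemma lt_of_real_eigenvector (hR : R.IsHermitian) {lam sig Lam : ℝ} (hlam : 0 < lam)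
    (hsig : 0 < sig) (hlamLam : lam ≤ Lam)
    (hP0 : ∀ x, 0 ≤ x ⬝ᵥ P *ᵥ x)
    (hR1 : ∀ y, lam * (y ⬝ᵥ y) ≤ y ⬝ᵥ R *ᵥ y)
    (hR2 : ∀ y, y ⬝ᵥ R *ᵥ y ≤ Lam * (y ⬝ᵥ y))
    (hQ : ∀ x, sig * (x ⬝ᵥ x) ≤ (Qᵀ *ᵥ x) ⬝ᵥ (Qᵀ *ᵥ x))
    {c : ℝ} {x : Fin m → ℝ} {y : Fin n → ℝ} (hxy : x ≠ 0 ∨ y ≠ 0)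
    (h1 : -(P *ᵥ x) + Q *ᵥ y = c • x) (h2 : -(Qᵀ *ᵥ x) - R *ᵥ y = c • y) :
    c < -(lam * sig / (lam * Lam + sig)) := by
  by_contra! hcon
  have hLam : 0 < Lam := hlam.trans_le hlamLam
  have hden : 0 < lam * Lam + sig := by positivity
  -- `rho` is smaller than both `lam` and `sig / Lam`
  set rho := lam * sig / (lam * Lam + sig) with hrho
  have hrho1 : rho < lam := by
    rw [hrho, div_lt_iff₀ hden]
    nlinarith [mul_pos hlam (mul_pos hlam hLam)]
  have hrho2 : rho * Lam < sig := by
    rw [hrho, div_mul_eq_mul_div, div_lt_iff₀ hden]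
    nlinarith [mul_pos hsig hsig]
  set S := R + c • (1 : Matrix (Fin n) (Fin n) ℝ) with hSdef
  have hSv : ∀ y, S *ᵥ y = R *ᵥ y + c • y := fun y => by
    rw [hSdef, add_mulVec, smul_mulVec, one_mulVec]
  have hS : S.IsHermitian := hR.add (by simp [Matrix.IsHermitian])
  have hSq : ∀ y, y ⬝ᵥ S *ᵥ y = y ⬝ᵥ R *ᵥ y + c * (y ⬝ᵥ y) := fun y => by
    rw [hSv, dotProduct_add, dotProduct_smul, smul_eq_mul]
  have hS1 : ∀ y, (lam + c) * (y ⬝ᵥ y) ≤ y ⬝ᵥ S *ᵥ y := fun y => by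
    rw [hSq]; linarith [hR1 y]
  have hSy : S *ᵥ y = -(Qᵀ *ᵥ x) := by rw [hSv, ← h2]; abel
  have hx : x ≠ 0 := by
    intro hx
    have hy : y ≠ 0 := hxy.resolve_left (not_not.2 hx)
    have hy' : 0 < y ⬝ᵥ y := by simpa using dotProduct_star_self_pos_iff.2 hy
    have := hS1 y
    rw [hSy, hx, mulVec_zero, neg_zero, dotProduct_zero] at this
    nlinarith
  have hx' : 0 < x ⬝ᵥ x := by simpa using dotProduct_star_self_pos_iff.2 hx
  have h3 := dotProduct_mulVec_self_le hS (μ := Lam + c) (by linarith)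
    (fun y => (mul_nonneg (by linarith) (real_dotProduct_self_nonneg y)).trans (hS1 y))
    (fun y => by rw [hSq]; linarith [hR2 y]) y
  rw [hSy, neg_dotProduct, dotProduct_neg, neg_neg, dotProduct_neg] at h3
  have h4 : x ⬝ᵥ Q *ᵥ y = c * (x ⬝ᵥ x) + x ⬝ᵥ P *ᵥ x := by
    have := congrArg (fun w => x ⬝ᵥ w) h1
    simp only [dotProduct_add, dotProduct_neg, dotProduct_smul, smul_eq_mul] at this
    linarith
  have h5 : y ⬝ᵥ Qᵀ *ᵥ x = x ⬝ᵥ Q *ᵥ y := by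
    rw [dotProduct_mulVec, vecMul_transpose, dotProduct_comm]
  have h6 := hQ x
  have h7 := hP0 x
  rw [h5, h4] at h3
  have h8 : sig * (x ⬝ᵥ x) ≤ (Lam + c) * -c * (x ⬝ᵥ x) := by nlinarith
  have h9 := le_of_mul_le_mul_right h8 hx'
  rcases le_or_gt 0 c with hc | hc
  · nlinarith
  · nlinarith

/-- The bound on the real part `α` of a non-real eigenvalue `α + iβ` of the saddle-point matrix with
blocks `-P, Q, -Qᵀ, -R`, in terms of the real part `(a₁, a₂)` and the imaginary part `(b₁, b₂)` of
an eigenvector: since `β ≠ 0`, both components of the eigenvector have the same norm. -/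
lemma re_le_of_complex_eigenvector (hP : P.IsHermitian) (hR : R.IsHermitian) {lamP lamR : ℝ}
    (hP1 : ∀ x, lamP * (x ⬝ᵥ x) ≤ x ⬝ᵥ P *ᵥ x)
    (hR1 : ∀ y, lamR * (y ⬝ᵥ y) ≤ y ⬝ᵥ R *ᵥ y)
    {α β : ℝ} (hβ : β ≠ 0) {a₁ b₁ : Fin m → ℝ} {a₂ b₂ : Fin n → ℝ}
    (hne : a₁ ≠ 0 ∨ b₁ ≠ 0 ∨ a₂ ≠ 0 ∨ b₂ ≠ 0)
    (ha₁ : -(P *ᵥ a₁) + Q *ᵥ a₂ = α • a₁ - β • b₁)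
    (ha₂ : -(Qᵀ *ᵥ a₁) - R *ᵥ a₂ = α • a₂ - β • b₂)
    (hb₁ : -(P *ᵥ b₁) + Q *ᵥ b₂ = β • a₁ + α • b₁)
    (hb₂ : -(Qᵀ *ᵥ b₁) - R *ᵥ b₂ = β • a₂ + α • b₂) :
    α ≤ -((lamP + lamR) / 2) := by
  have hsym : ∀ {d : ℕ} {S : Matrix (Fin d) (Fin d) ℝ}, S.IsHermitian → ∀ a b : Fin d → ℝ,
      a ⬝ᵥ S *ᵥ b = b ⬝ᵥ S *ᵥ a := by
    intro d S hS a b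
    have hT : Sᵀ = S := by simpa using hS.eq
    rw [dotProduct_mulVec, ← mulVec_transpose, hT, dotProduct_comm]
  have hQt : ∀ (y : Fin n → ℝ) (x : Fin m → ℝ), y ⬝ᵥ Qᵀ *ᵥ x = x ⬝ᵥ Q *ᵥ y := fun y x => by
    rw [dotProduct_mulVec, vecMul_transpose, dotProduct_comm]
  have e : ∀ {d : ℕ} {u w : Fin d → ℝ}, u = w → ∀ x, x ⬝ᵥ u = x ⬝ᵥ w := fun h x => by rw [h]
  have A1 := e ha₁ a₁
  have A2 := e ha₁ b₁
  have B1 := e hb₁ b₁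
  have B2 := e hb₁ a₁
  have C1 := e ha₂ a₂
  have C2 := e ha₂ b₂
  have D1 := e hb₂ b₂
  have D2 := e hb₂ a₂
  simp only [dotProduct_add, dotProduct_sub, dotProduct_neg, dotProduct_smul, smul_eq_mul, hQt]
    at A1 A2 B1 B2 C1 C2 D1 D2
  rw [hsym hP b₁ a₁, dotProduct_comm b₁ a₁] at *
  rw [hsym hR b₂ a₂, dotProduct_comm b₂ a₂] at *
  set X := a₁ ⬝ᵥ a₁ + b₁ ⬝ᵥ b₁ with hX
  set Y := a₂ ⬝ᵥ a₂ + b₂ ⬝ᵥ b₂ with hY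
  -- both sides equal `a₁ ⬝ᵥ Q *ᵥ b₂ - b₁ ⬝ᵥ Q *ᵥ a₂`
  have hXY : β * X = β * Y := by rw [hX, hY]; linarith
  have hXY' : X = Y := mul_left_cancel₀ hβ hXY
  have hsum : α * (X + Y) = -(a₁ ⬝ᵥ P *ᵥ a₁ + b₁ ⬝ᵥ P *ᵥ b₁ + a₂ ⬝ᵥ R *ᵥ a₂ + b₂ ⬝ᵥ R *ᵥ b₂) := by
    rw [hX, hY]; linarith
  have hXpos : 0 < X + Y := by
    have h1 := real_dotProduct_self_nonneg a₁
    have h2 := real_dotProduct_self_nonneg b₁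
    have h3 := real_dotProduct_self_nonneg a₂
    have h4 := real_dotProduct_self_nonneg b₂
    have hpos : ∀ {d : ℕ} {x : Fin d → ℝ}, x ≠ 0 → 0 < x ⬝ᵥ x := fun hx => by
      simpa using dotProduct_star_self_pos_iff.2 hx
    rcases hne with h | h | h | h <;> have := hpos h <;> rw [hX, hY] <;> linarith
  have hb : α * (X + Y) ≤ -((lamP + lamR) / 2) * (X + Y) := by
    have e1 : (lamP + lamR) / 2 * (X + Y) = lamP * X + lamR * Y := by rw [hXY']; ring
    rw [hsum, neg_mul, e1, hX, hY]
    linarith [hP1 a₁, hP1 b₁, hR1 a₂, hR1 b₂]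
  exact le_of_mul_le_mul_right hb hXpos

end EigenvalueBounds

/-! ### The spectrum of the saddle-point matrix -/

section SaddleBounds

open Matrix

variable {m n : ℕ} {P : Matrix (Fin m) (Fin m) ℝ} {Q : Matrix (Fin m) (Fin n) ℝ}
  {R : Matrix (Fin n) (Fin n) ℝ}

/-- A complex eigenvector of a real matrix, split into real and imaginary part. -/
lemma exists_re_im_of_mem_eigenvalueSet {ι : Type*} [Fintype ι] [DecidableEq ι]
    {A : Matrix ι ι ℝ} {c : ℂ} (hc : c ∈ eigenvalueSet (A.map ((↑) : ℝ → ℂ))) :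
    ∃ a b : ι → ℝ, (a ≠ 0 ∨ b ≠ 0) ∧ A *ᵥ a = c.re • a - c.im • b ∧
      A *ᵥ b = c.im • a + c.re • b := by
  obtain ⟨x, hx, h⟩ := mem_eigenvalueSet_iff.1 hc
  refine ⟨fun i => (x i).re, fun i => (x i).im, ?_, ?_, ?_⟩
  · by_contra! h0
    exact hx (funext fun i => Complex.ext (congrFun h0.1 i) (congrFun h0.2 i))
  · ext i
    have := congrArg Complex.re (congrFun h i)
    simpa [mulVec, dotProduct, Complex.re_sum] using this
  · ext i
    have := congrArg Complex.im (congrFun h i)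
    simpa [mulVec, dotProduct, Complex.im_sum, add_comm] using this

lemma eigMin_mul_transpose_pos (hm : 0 < m) (hQ : FullColumnRank Qᵀ) : 0 < eigMin (Q * Qᵀ) := by
  refine eigMin_pos (by simpa using posSemidef_self_mul_conjTranspose Q) hm fun x hx => ?_
  refine hQ.eq_zero_of_mulVec_eq_zero ?_
  have h1 : (Qᵀ *ᵥ x) ⬝ᵥ (Qᵀ *ᵥ x) = 0 := by
    have := congrArg (fun w => x ⬝ᵥ w) hx
    rw [← mulVec_mulVec] at this
    simp only [dotProduct_zero] at this
    rw [dotProduct_mulVec, ← mulVec_transpose] at this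
    exact this
  exact dotProduct_self_eq_zero.1 h1

/-- The eigenvalue bounds for `k` times the matrix with blocks `-P, Q, -Qᵀ, -R`. -/
theorem saddle_eigenvalue_bounds (hm : 0 < m) (hP : P.PosSemidef) (hR : R.PosSemidef)
    (hRr : FullColumnRank R) (hQ : FullColumnRank Qᵀ) {k : ℝ} (hk : 0 < k) {c : ℂ}
    (hc : c ∈ eigenvalueSet ((k • fromBlocks (-P) Q (-Qᵀ) (-R)).map ((↑) : ℝ → ℂ))) :
    c.re < 0 ∧
      (c.im = 0 →
        c.re < -(k * (eigMin R * eigMin (Q * Qᵀ)) /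
            (eigMin R * max (eigMax P) (eigMax R) + eigMin (Q * Qᵀ))) ∧
        -(k * (eigMin R * eigMin (Q * Qᵀ)) /
            (eigMin R * max (eigMax P) (eigMax R) + eigMin (Q * Qᵀ))) < 0) ∧
      (c.im ≠ 0 →
        c.re ≤ -(k / 2 * (eigMin P + eigMin R)) ∧ -(k / 2 * (eigMin P + eigMin R)) < 0) := by
  have hn : 0 < n := by
    rcases Nat.eq_zero_or_pos n with rfl | h
    · have := congrFun (hQ.eq_zero_of_mulVec_eq_zero
        (x := fun _ => 1) (Subsingleton.elim _ _)) ⟨0, hm⟩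
      simp at this
    · exact h
  have hlam : 0 < eigMin R := eigMin_pos hR hn fun x hx => hRr.eq_zero_of_mulVec_eq_zero hx
  have hsig : 0 < eigMin (Q * Qᵀ) := eigMin_mul_transpose_pos hm hQ
  have hLam : eigMin R ≤ max (eigMax P) (eigMax R) :=
    (eigMin_le_eigMax hR.1 hn).trans (le_max_right _ _)
  have hlamP : 0 ≤ eigMin P := eigMin_nonneg hP hm
  have hQx : ∀ x, eigMin (Q * Qᵀ) * (x ⬝ᵥ x) ≤ (Qᵀ *ᵥ x) ⬝ᵥ (Qᵀ *ᵥ x) := fun x => by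
    have h1 := eigMin_mul_le (S := Q * Qᵀ) (by simpa using isHermitian_mul_conjTranspose_self Q) x
    rwa [← mulVec_mulVec, dotProduct_mulVec, ← mulVec_transpose] at h1
  have hR2 : ∀ y, y ⬝ᵥ R *ᵥ y ≤ max (eigMax P) (eigMax R) * (y ⬝ᵥ y) := fun y =>
    (le_eigMax_mul hR.1 y).trans
      (mul_le_mul_of_nonneg_right (le_max_right _ _) (real_dotProduct_self_nonneg y))
  have hP0 : ∀ x, 0 ≤ x ⬝ᵥ P *ᵥ x := fun x => by simpa using hP.dotProduct_mulVec_nonneg x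
  obtain ⟨a, b, hab, ha, hb⟩ := exists_re_im_of_mem_eigenvalueSet hc
  have hblk : ∀ (x u : Fin m ⊕ Fin n → ℝ), (k • fromBlocks (-P) Q (-Qᵀ) (-R)) *ᵥ x = u →
      -(P *ᵥ (x ∘ Sum.inl)) + Q *ᵥ (x ∘ Sum.inr) = k⁻¹ • (u ∘ Sum.inl) ∧
      -(Qᵀ *ᵥ (x ∘ Sum.inl)) - R *ᵥ (x ∘ Sum.inr) = k⁻¹ • (u ∘ Sum.inr) := by
    rintro x u rfl
    rw [smul_mulVec, fromBlocks_mulVec]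
    constructor <;> ext i <;> simp [neg_mulVec, hk.ne', sub_eq_add_neg]
  obtain ⟨ha₁, ha₂⟩ := hblk _ _ ha
  obtain ⟨hb₁, hb₂⟩ := hblk _ _ hb
  have hsplit : ∀ x : Fin m ⊕ Fin n → ℝ, x ≠ 0 → x ∘ Sum.inl ≠ 0 ∨ x ∘ Sum.inr ≠ 0 := by
    intro x hx
    by_contra! h
    refine hx (funext fun i => ?_)
    rcases i with i | i
    exacts [congrFun h.1 i, congrFun h.2 i]
  have hreal : c.im = 0 → c.re < -(k * (eigMin R * eigMin (Q * Qᵀ)) /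
      (eigMin R * max (eigMax P) (eigMax R) + eigMin (Q * Qᵀ))) := by
    intro him
    have key : k⁻¹ * c.re < -(eigMin R * eigMin (Q * Qᵀ) /
        (eigMin R * max (eigMax P) (eigMax R) + eigMin (Q * Qᵀ))) := by
      rcases hab with h | h
      · exact lt_of_real_eigenvector hR.1 hlam hsig hLam hP0 (eigMin_mul_le hR.1) hR2 hQx
          (hsplit a h) (by rw [ha₁, him]; ext i; simp [mul_assoc])
          (by rw [ha₂, him]; ext i; simp [mul_assoc])
      · exact lt_of_real_eigenvector hR.1 hlam hsig hLam hP0 (eigMin_mul_le hR.1) hR2 hQx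
          (hsplit b h) (by rw [hb₁, him]; ext i; simp [mul_assoc])
          (by rw [hb₂, him]; ext i; simp [mul_assoc])
    rw [inv_mul_lt_iff₀ hk] at key
    rw [mul_div_assoc, ← mul_neg]
    exact key
  have hrealneg : -(k * (eigMin R * eigMin (Q * Qᵀ)) /
      (eigMin R * max (eigMax P) (eigMax R) + eigMin (Q * Qᵀ))) < 0 := by
    have : 0 < max (eigMax P) (eigMax R) := hlam.trans_le hLam
    rw [neg_lt_zero]
    positivity
  have hcomplex : c.im ≠ 0 → c.re ≤ -(k / 2 * (eigMin P + eigMin R)) := by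
    intro him
    have hne : a ∘ Sum.inl ≠ 0 ∨ b ∘ Sum.inl ≠ 0 ∨ a ∘ Sum.inr ≠ 0 ∨ b ∘ Sum.inr ≠ 0 := by
      rcases hab with h | h <;> rcases hsplit _ h with h' | h' <;> simp [h']
    have key := re_le_of_complex_eigenvector (Q := Q) hP.1 hR.1 (eigMin_mul_le hP.1)
      (eigMin_mul_le hR.1) (α := k⁻¹ * c.re) (β := k⁻¹ * c.im)
      (mul_ne_zero (inv_ne_zero hk.ne') him) hne
      (by rw [ha₁]; ext i; simp; ring) (by rw [ha₂]; ext i; simp; ring)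
      (by rw [hb₁]; ext i; simp; ring) (by rw [hb₂]; ext i; simp; ring)
    rw [inv_mul_le_iff₀ hk] at key
    linarith
  have hcomplexneg : -(k / 2 * (eigMin P + eigMin R)) < 0 := by
    have : 0 < eigMin P + eigMin R := by linarith
    rw [neg_lt_zero]
    positivity
  refine ⟨?_, fun h => ⟨hreal h, hrealneg⟩, fun h => ⟨hcomplex h, hcomplexneg⟩⟩
  by_cases h : c.im = 0
  · exact (hreal h).trans hrealneg
  · exact (hcomplex h).trans_lt hcomplexneg

end SaddleBounds

/-! ### Functions with a locally Lipschitz derivative -/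

section BoundedDerivatives

open Asymptotics
open scoped NNReal

variable {W G G' : Type*} [NormedAddCommGroup W] [NormedSpace ℝ W] [NormedAddCommGroup G]
  [NormedSpace ℝ G] [NormedAddCommGroup G'] [NormedSpace ℝ G'] {w₀ : W}

/-- `F` is differentiable near `w₀`, with a derivative that is bounded near `w₀`. -/
def HasBoundedFDerivNear (F : W → G) (w₀ : W) : Prop :=
  (∀ᶠ w in 𝓝 w₀, DifferentiableAt ℝ F w) ∧ fderiv ℝ F =O[𝓝 w₀] (fun _ => (1 : ℝ))

namespace HasBoundedFDerivNear

lemma differentiableAt {F : W → G} (hF : HasBoundedFDerivNear F w₀) : DifferentiableAt ℝ F w₀ :=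
  hF.1.self_of_nhds

lemma isBigO_one {F : W → G} (hF : HasBoundedFDerivNear F w₀) :
    F =O[𝓝 w₀] (fun _ => (1 : ℝ)) :=
  hF.differentiableAt.continuousAt.isBigO_one ℝ

lemma of_hasFDerivAt {F : W → G} {F' : W → W →L[ℝ] G}
    (h : ∀ᶠ w in 𝓝 w₀, HasFDerivAt F (F' w) w) (hb : F' =O[𝓝 w₀] (fun _ => (1 : ℝ))) :
    HasBoundedFDerivNear F w₀ :=
  ⟨h.mono fun _ hw => hw.differentiableAt,
    hb.congr' (h.mono fun _ hw => hw.fderiv.symm) EventuallyEq.rfl⟩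

lemma congr {F F₁ : W → G} (hF : HasBoundedFDerivNear F w₀) (h : F₁ =ᶠ[𝓝 w₀] F) :
    HasBoundedFDerivNear F₁ w₀ :=
  of_hasFDerivAt (F' := fderiv ℝ F)
    (by
      filter_upwards [h.eventuallyEq_nhds, hF.1] with w h1 h2
      exact h2.hasFDerivAt.congr_of_eventuallyEq h1) hF.2

lemma sub {F F₁ : W → G} (hF : HasBoundedFDerivNear F w₀) (hF₁ : HasBoundedFDerivNear F₁ w₀) :
    HasBoundedFDerivNear (fun w => F w - F₁ w) w₀ :=
  of_hasFDerivAt ((hF.1.and hF₁.1).mono fun _ h => h.1.hasFDerivAt.sub h.2.hasFDerivAt)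
    (hF.2.sub hF₁.2)

lemma add {F F₁ : W → G} (hF : HasBoundedFDerivNear F w₀) (hF₁ : HasBoundedFDerivNear F₁ w₀) :
    HasBoundedFDerivNear (fun w => F w + F₁ w) w₀ :=
  of_hasFDerivAt ((hF.1.and hF₁.1).mono fun _ h => h.1.hasFDerivAt.add h.2.hasFDerivAt)
    (hF.2.add hF₁.2)

lemma clm_comp {F : W → G} (L : G →L[ℝ] G') (hF : HasBoundedFDerivNear F w₀) :
    HasBoundedFDerivNear (fun w => L (F w)) w₀ := by
  refine of_hasFDerivAt (F' := fun w => L.comp (fderiv ℝ F w))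
    (hF.1.mono fun w h => L.hasFDerivAt.comp w h.hasFDerivAt) ?_
  refine (IsBigO.of_bound ‖L‖ (Eventually.of_forall fun w => ?_)).trans hF.2
  exact L.opNorm_comp_le _

lemma comp_clm {F : W → G} {W' : Type*} [NormedAddCommGroup W'] [NormedSpace ℝ W'] {w₁ : W'}
    (L : W' →L[ℝ] W) (hF : HasBoundedFDerivNear F (L w₁)) :
    HasBoundedFDerivNear (fun w => F (L w)) w₁ := by
  have hL : Tendsto L (𝓝 w₁) (𝓝 (L w₁)) := L.continuous.continuousAt
  refine of_hasFDerivAt (F' := fun w => (fderiv ℝ F (L w)).comp L)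
    ((hL.eventually hF.1).mono fun w h => h.hasFDerivAt.comp w L.hasFDerivAt) ?_
  refine (IsBigO.of_bound ‖L‖ (Eventually.of_forall fun w => ?_)).trans (hF.2.comp_tendsto hL)
  rw [mul_comm]
  exact ContinuousLinearMap.opNorm_comp_le _ _

lemma smul {c : W → ℝ} {F : W → G} (hc : HasBoundedFDerivNear c w₀)
    (hF : HasBoundedFDerivNear F w₀) : HasBoundedFDerivNear (fun w => c w • F w) w₀ := by
  refine of_hasFDerivAt ((hc.1.and hF.1).mono fun w h => h.1.hasFDerivAt.smul h.2.hasFDerivAt) ?_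
  refine IsBigO.add ?_ ?_
  · simpa using hc.isBigO_one.smul hF.2
  · have h1 : (fun w => (fderiv ℝ c w).smulRight (F w)) =O[𝓝 w₀]
        (fun w => ‖fderiv ℝ c w‖ * ‖F w‖) :=
      IsBigO.of_bound 1 (Eventually.of_forall fun w => by simp)
    refine h1.trans ?_
    simpa using hc.2.norm_left.mul hF.isBigO_one.norm_left

lemma inv {c : W → ℝ} (hc : HasBoundedFDerivNear c w₀) (h0 : c w₀ ≠ 0) :
    HasBoundedFDerivNear (fun w => (c w)⁻¹) w₀ := by
  have hcont := hc.differentiableAt.continuousAt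
  have hne : ∀ᶠ w in 𝓝 w₀, c w ≠ 0 := hcont.eventually_ne h0
  refine of_hasFDerivAt (F' := fun w => -(c w ^ 2)⁻¹ • fderiv ℝ c w)
    ((hc.1.and hne).mono fun w h => (hasDerivAt_inv h.2).comp_hasFDerivAt w h.1.hasFDerivAt) ?_
  have h1 : (fun w => -(c w ^ 2)⁻¹) =O[𝓝 w₀] (fun _ => (1 : ℝ)) :=
    ((hcont.pow 2).inv₀ (pow_ne_zero 2 h0)).neg.isBigO_one ℝ
  simpa using h1.smul hc.2

lemma exists_lipschitzOnWith {F : W → G} (hF : HasBoundedFDerivNear F w₀) :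
    ∃ R > 0, ∃ K : ℝ≥0, LipschitzOnWith K F (Metric.closedBall w₀ R) := by
  obtain ⟨C, hC⟩ := hF.2.bound
  obtain ⟨R, hR, h⟩ := Metric.nhds_basis_closedBall.eventually_iff.1 (hF.1.and hC)
  refine ⟨R, hR, C.toNNReal, (convex_closedBall w₀ R).lipschitzOnWith_of_nnnorm_fderiv_le
    (fun w hw => (h hw).1) fun w hw => ?_⟩
  rw [← NNReal.coe_le_coe, coe_nnnorm]
  have := (h hw).2
  simp only [norm_one, mul_one] at this
  exact this.trans (Real.le_coe_toNNReal C)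

end HasBoundedFDerivNear

/-- `F` is twice differentiable near `w₀`, with bounded first and second derivatives. -/
structure HasTwoBoundedFDerivNear (F : W → ℝ) (w₀ : W) : Prop where
  first : HasBoundedFDerivNear F w₀
  second : HasBoundedFDerivNear (fderiv ℝ F) w₀

namespace HasTwoBoundedFDerivNear

lemma sub {F F₁ : W → ℝ} (hF : HasTwoBoundedFDerivNear F w₀)
    (hF₁ : HasTwoBoundedFDerivNear F₁ w₀) : HasTwoBoundedFDerivNear (fun w => F w - F₁ w) w₀ :=
  ⟨hF.first.sub hF₁.first, (hF.second.sub hF₁.second).congr <|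
    (hF.first.1.and hF₁.first.1).mono fun _ h => (h.1.hasFDerivAt.sub h.2.hasFDerivAt).fderiv⟩

lemma fderiv_mul_eventuallyEq {F F₁ : W → ℝ} (hF : HasTwoBoundedFDerivNear F w₀)
    (hF₁ : HasTwoBoundedFDerivNear F₁ w₀) :
    fderiv ℝ (fun w => F w * F₁ w) =ᶠ[𝓝 w₀] fun w => F w • fderiv ℝ F₁ w + F₁ w • fderiv ℝ F w :=
  (hF.first.1.and hF₁.first.1).mono fun _ h => (h.1.hasFDerivAt.mul h.2.hasFDerivAt).fderiv

lemma mul {F F₁ : W → ℝ} (hF : HasTwoBoundedFDerivNear F w₀)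
    (hF₁ : HasTwoBoundedFDerivNear F₁ w₀) : HasTwoBoundedFDerivNear (fun w => F w * F₁ w) w₀ :=
  ⟨hF.first.smul hF₁.first, ((hF.first.smul hF₁.second).add (hF₁.first.smul hF.second)).congr <|
    hF.fderiv_mul_eventuallyEq hF₁⟩

lemma fderiv_sub_mul_eventuallyEq {F F₁ F₂ : W → ℝ} (hF : HasTwoBoundedFDerivNear F w₀)
    (hF₁ : HasTwoBoundedFDerivNear F₁ w₀) (hF₂ : HasTwoBoundedFDerivNear F₂ w₀) :
    fderiv ℝ (fun w => F w - F₁ w * F₂ w) =ᶠ[𝓝 w₀]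
      fun w => fderiv ℝ F w - (F₁ w • fderiv ℝ F₂ w + F₂ w • fderiv ℝ F₁ w) := by
  filter_upwards [hF.first.1, (hF₁.mul hF₂).first.1, hF₁.fderiv_mul_eventuallyEq hF₂]
    with w h1 h2 h3
  have h4 := (h1.hasFDerivAt.sub h2.hasFDerivAt).fderiv
  rw [h3] at h4
  exact h4

lemma fderiv_fderiv_sub_mul {F F₁ F₂ : W → ℝ} (hF : HasTwoBoundedFDerivNear F w₀)
    (hF₁ : HasTwoBoundedFDerivNear F₁ w₀) (hF₂ : HasTwoBoundedFDerivNear F₂ w₀) (v v' : W) :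
    fderiv ℝ (fderiv ℝ fun w => F w - F₁ w * F₂ w) w₀ v v' =
      fderiv ℝ (fderiv ℝ F) w₀ v v' -
        ((F₁ w₀ * fderiv ℝ (fderiv ℝ F₂) w₀ v v' + fderiv ℝ F₁ w₀ v * fderiv ℝ F₂ w₀ v') +
          (F₂ w₀ * fderiv ℝ (fderiv ℝ F₁) w₀ v v' + fderiv ℝ F₂ w₀ v * fderiv ℝ F₁ w₀ v')) := by
  have h := hF.second.differentiableAt.hasFDerivAt.sub
    ((hF₁.first.differentiableAt.hasFDerivAt.smul hF₂.second.differentiableAt.hasFDerivAt).add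
    (hF₂.first.differentiableAt.hasFDerivAt.smul hF₁.second.differentiableAt.hasFDerivAt))
  rw [(h.congr_of_eventuallyEq (hF.fderiv_sub_mul_eventuallyEq hF₁ hF₂)).fderiv]
  rfl

lemma inv {F : W → ℝ} (hF : HasTwoBoundedFDerivNear F w₀) (h0 : F w₀ ≠ 0) :
    HasTwoBoundedFDerivNear (fun w => (F w)⁻¹) w₀ := by
  have hi := hF.first.inv h0
  refine ⟨hi, (((hi.smul hi).smul hF.second).clm_comp (-ContinuousLinearMap.id ℝ _)).congr ?_⟩
  filter_upwards [hF.first.1, hF.first.differentiableAt.continuousAt.eventually_ne h0] with w h1 h2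
  have h3 : HasFDerivAt (fun w => (F w)⁻¹) (-(F w ^ 2)⁻¹ • fderiv ℝ F w) w :=
    (hasDerivAt_inv h2).comp_hasFDerivAt w h1.hasFDerivAt
  rw [h3.fderiv]
  simp only [neg_smul, _root_.neg_apply, ContinuousLinearMap.id_apply, smul_eq_mul]
  rw [pow_two, mul_inv]

lemma comp_clm {F : W → ℝ} {W' : Type*} [NormedAddCommGroup W'] [NormedSpace ℝ W'] {w₁ : W'}
    (L : W' →L[ℝ] W) (hF : HasTwoBoundedFDerivNear F (L w₁)) :
    HasTwoBoundedFDerivNear (fun w => F (L w)) w₁ := by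
  refine ⟨hF.first.comp_clm L, ((hF.second.comp_clm L).clm_comp
    ((ContinuousLinearMap.compL ℝ W' W ℝ).flip L)).congr ?_⟩
  have hL : Tendsto L (𝓝 w₁) (𝓝 (L w₁)) := L.continuous.continuousAt
  filter_upwards [hL.eventually hF.first.1] with w h
  exact (h.hasFDerivAt.comp w L.hasFDerivAt).fderiv

end HasTwoBoundedFDerivNear

end BoundedDerivatives

/-! ### Differentiating twice under the integral sign -/

section Leibniz

open Asymptotics

variable {𝒳 W : Type*} [MeasurableSpace 𝒳] {μ : Measure 𝒳} [NormedAddCommGroup W]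
  [NormedSpace ℝ W] [FiniteDimensional ℝ W]

lemma aestronglyMeasurable_clm_of_apply {G : Type*} [NormedAddCommGroup G] [NormedSpace ℝ G]
    {F : 𝒳 → W →L[ℝ] G} (hF : ∀ e, AEStronglyMeasurable (fun x => F x e) μ) :
    AEStronglyMeasurable F μ := by
  set b := Module.finBasis ℝ W
  have hrep : F = fun x => ∑ i, (ContinuousLinearMap.smulRightL ℝ W G
      (LinearMap.toContinuousLinearMap (b.coord i))) (F x (b i)) := by
    ext x w
    rw [_root_.sum_apply]
    conv_lhs => rw [← b.sum_repr w, map_sum]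
    simp
  rw [hrep]
  exact Finset.aestronglyMeasurable_fun_sum _ fun i _ =>
    (ContinuousLinearMap.continuous _).comp_aestronglyMeasurable (hF (b i))

/-- Derivatives in a parameter are measurable, as limits of difference quotients. -/
lemma aestronglyMeasurable_fderiv {G : Type*} [NormedAddCommGroup G] [NormedSpace ℝ G]
    {F : 𝒳 → W → G} {w : W} (hF : ∀ᶠ w' in 𝓝 w, AEStronglyMeasurable (fun x => F x w') μ)
    (hd : ∀ x, DifferentiableAt ℝ (F x) w) :
    AEStronglyMeasurable (fun x => fderiv ℝ (F x) w) μ := by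
  refine aestronglyMeasurable_clm_of_apply fun e => ?_
  have hinv : Tendsto (fun n : ℕ => w + ((n : ℝ))⁻¹ • e) atTop (𝓝 w) := by
    simpa using ((tendsto_inv_atTop_nhds_zero_nat (𝕜 := ℝ)).smul_const e).const_add w
  obtain ⟨N, hN⟩ := eventually_atTop.1 (hinv.eventually hF)
  have hw := hF.self_of_nhds
  refine aestronglyMeasurable_of_tendsto_ae (u := atTop)
    (f := fun (n : ℕ) x => ((n + N : ℕ) : ℝ) • (F x (w + (((n + N : ℕ) : ℝ))⁻¹ • e) - F x w))
    (fun n => ((hN (n + N) (by omega)).sub hw).const_smul _) (ae_of_all _ fun x => ?_)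
  refine (hd x).hasFDerivAt.lim (l := atTop) e ?_
  exact tendsto_norm_atTop_atTop.comp
    (tendsto_natCast_atTop_atTop.comp (tendsto_add_atTop_nat N))

/-- The Leibniz rule of order one, with the derivative described by its values. -/
lemma exists_hasFDerivAt_integral {G : Type*} [NormedAddCommGroup G] [NormedSpace ℝ G]
    [CompleteSpace G] {F : 𝒳 → W → G} {V : Set W} (hV : IsOpen V) {g : 𝒳 → ℝ} (hg : Integrable g μ)
    (hbd : ∀ᵐ x ∂μ, ∀ w ∈ V, ‖F x w‖ ≤ g x ∧ ‖fderiv ℝ (F x) w‖ ≤ g x)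
    (hd : ∀ x, ∀ w ∈ V, DifferentiableAt ℝ (F x) w)
    (hm : ∀ w ∈ V, AEStronglyMeasurable (fun x => F x w) μ) {w : W} (hw : w ∈ V) :
    (∀ e, Integrable (fun x => fderiv ℝ (F x) w e) μ) ∧
    ∃ D : W →L[ℝ] G, HasFDerivAt (fun w => ∫ x, F x w ∂μ) D w ∧ ‖D‖ ≤ ∫ x, g x ∂μ ∧
      ∀ e, D e = ∫ x, fderiv ℝ (F x) w e ∂μ := by
  have hm' : ∀ᶠ w' in 𝓝 w, AEStronglyMeasurable (fun x => F x w') μ :=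
    Filter.mem_of_superset (hV.mem_nhds hw) hm
  have hm1 : AEStronglyMeasurable (fun x => fderiv ℝ (F x) w) μ :=
    aestronglyMeasurable_fderiv hm' fun x => hd x w hw
  have hi : Integrable (fun x => fderiv ℝ (F x) w) μ :=
    hg.mono' hm1 (hbd.mono fun x hx => (hx w hw).2)
  refine ⟨fun e => hi.apply_continuousLinearMap e, ∫ x, fderiv ℝ (F x) w ∂μ, ?_,
    norm_integral_le_of_norm_le hg (hbd.mono fun x hx => (hx w hw).2),
    fun e => ContinuousLinearMap.integral_apply hi e⟩
  exact hasFDerivAt_integral_of_dominated_of_fderiv_le (hV.mem_nhds hw)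
    (F := fun w x => F x w) (F' := fun w x => fderiv ℝ (F x) w) (bound := g) hm'
    (hg.mono' (hm w hw) (hbd.mono fun x hx => (hx w hw).1)) hm1
    (hbd.mono fun x hx w' hw' => (hx w' hw').2) hg
    (ae_of_all _ fun x w' hw' => (hd x w' hw').hasFDerivAt)

/-- The conclusions of the Leibniz rule of order two, with the derivatives described by their
values. -/
lemma LocallyDominated.leibniz {Φ : 𝒳 → W → ℝ} {w₀ : W} (hdom : LocallyDominated μ Φ w₀)
    {U : Set W} (hU : IsOpen U) (hw₀ : w₀ ∈ U) (hd : ∀ x, TwiceDifferentiableOn (Φ x) U)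
    (hmeas : ∀ w, AEStronglyMeasurable (fun x => Φ x w) μ) :
    Integrable (fun x => Φ x w₀) μ ∧
    (∀ e e', Integrable (fun x => fderiv ℝ (fderiv ℝ (Φ x)) w₀ e e') μ) ∧
    (∀ e, fderiv ℝ (fun w => ∫ x, Φ x w ∂μ) w₀ e = ∫ x, fderiv ℝ (Φ x) w₀ e ∂μ) ∧
    (∀ e e', fderiv ℝ (fderiv ℝ fun w => ∫ x, Φ x w ∂μ) w₀ e e' =
      ∫ x, fderiv ℝ (fderiv ℝ (Φ x)) w₀ e e' ∂μ) ∧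
    HasTwoBoundedFDerivNear (fun w => ∫ x, Φ x w ∂μ) w₀ := by
  obtain ⟨U', hU', hw₀', g, hg, hbd⟩ := hdom
  set V := U ∩ U' with hV
  have hVo : IsOpen V := hU.inter hU'
  have hd1 : ∀ x, ∀ w ∈ V, DifferentiableAt ℝ (Φ x) w := fun x w hw =>
    (hd x).1.differentiableAt (hU.mem_nhds hw.1)
  have hd2 : ∀ x, ∀ w ∈ V, DifferentiableAt ℝ (fderiv ℝ (Φ x)) w := fun x w hw =>
    (hd x).2.differentiableAt (hU.mem_nhds hw.1)
  have hm1 : ∀ w ∈ V, AEStronglyMeasurable (fun x => fderiv ℝ (Φ x) w) μ := fun w hw =>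
    aestronglyMeasurable_fderiv (Eventually.of_forall hmeas) fun x => hd1 x w hw
  have hbd1 : ∀ᵐ x ∂μ, ∀ w ∈ V, ‖Φ x w‖ ≤ g x ∧ ‖fderiv ℝ (Φ x) w‖ ≤ g x :=
    hbd.mono fun x hx w hw => ⟨(hx w hw.2).1, (hx w hw.2).2.1⟩
  have hbd2 : ∀ᵐ x ∂μ, ∀ w ∈ V, ‖fderiv ℝ (Φ x) w‖ ≤ g x ∧
      ‖fderiv ℝ (fderiv ℝ (Φ x)) w‖ ≤ g x := hbd.mono fun x hx w hw => (hx w hw.2).2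
  have L1 := fun w (hw : w ∈ V) => exists_hasFDerivAt_integral hVo hg hbd1 hd1
    (fun w _ => hmeas w) hw
  have L2 := fun w (hw : w ∈ V) => exists_hasFDerivAt_integral hVo hg hbd2 hd2 hm1 hw
  have hi1 : ∀ w ∈ V, Integrable (fun x => fderiv ℝ (Φ x) w) μ := fun w hw =>
    hg.mono' (hm1 w hw) (hbd1.mono fun x hx => (hx w hw).2)
  -- the derivative of the integral is the integral of the derivative throughout `V`
  have hD : ∀ w ∈ V, fderiv ℝ (fun w => ∫ x, Φ x w ∂μ) w = ∫ x, fderiv ℝ (Φ x) w ∂μ := by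
    intro w hw
    obtain ⟨-, D, h1, -, h2⟩ := L1 w hw
    ext e
    rw [h1.fderiv, h2, ContinuousLinearMap.integral_apply (hi1 w hw)]
  have hD2 : ∀ w ∈ V, ∃ D : W →L[ℝ] W →L[ℝ] ℝ,
      HasFDerivAt (fderiv ℝ fun w => ∫ x, Φ x w ∂μ) D w ∧ ‖D‖ ≤ ∫ x, g x ∂μ ∧
      ∀ e, D e = ∫ x, fderiv ℝ (fderiv ℝ (Φ x)) w e ∂μ := by
    intro w hw
    obtain ⟨-, D, h1, h2, h3⟩ := L2 w hw
    exact ⟨D, h1.congr_of_eventuallyEq (Filter.mem_of_superset (hVo.mem_nhds hw) hD), h2, h3⟩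
  have hwV : w₀ ∈ V := ⟨hw₀, hw₀'⟩
  have hev : ∀ᶠ w in 𝓝 w₀, w ∈ V := hVo.mem_nhds hwV
  refine ⟨hg.mono' (hmeas w₀) (hbd1.mono fun x hx => (hx w₀ hwV).1),
    fun e e' => ((L2 w₀ hwV).1 e).apply_continuousLinearMap e', fun e => ?_, fun e e' => ?_,
    ⟨hev.mono fun w hw => ?_, IsBigO.of_bound (∫ x, g x ∂μ) (hev.mono fun w hw => ?_)⟩,
    ⟨hev.mono fun w hw => ?_, IsBigO.of_bound (∫ x, g x ∂μ) (hev.mono fun w hw => ?_)⟩⟩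
  · rw [hD w₀ hwV, ContinuousLinearMap.integral_apply (hi1 w₀ hwV)]
  · obtain ⟨D, h1, -, h3⟩ := hD2 w₀ hwV
    rw [h1.fderiv, h3, ContinuousLinearMap.integral_apply ((L2 w₀ hwV).1 e)]
  · obtain ⟨-, D, h1, -, -⟩ := L1 w hw
    exact h1.differentiableAt
  · obtain ⟨-, D, h1, h2, -⟩ := L1 w hw
    rw [h1.fderiv]
    simpa using h2
  · obtain ⟨D, h1, -, -⟩ := hD2 w hw
    exact h1.differentiableAt
  · obtain ⟨D, h1, h2, -⟩ := hD2 w hw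
    rw [h1.fderiv]
    simpa using h2

end Leibniz

/-! ### Generators and their conjugates -/

section Generators

namespace IsGenerator

variable {f : ℝ → ℝ}

lemma hasDerivAt (hf : IsGenerator f) {s : ℝ} (hs : 0 < s) : HasDerivAt f (deriv f s) s :=
  (hf.diff₁.differentiableAt (Ioi_mem_nhds hs)).hasDerivAt

lemma hasDerivAt_deriv (hf : IsGenerator f) {s : ℝ} (hs : 0 < s) :
    HasDerivAt (deriv f) (deriv (deriv f) s) s :=
  (hf.diff₂.differentiableAt (Ioi_mem_nhds hs)).hasDerivAt

lemma tangent_le (hf : IsGenerator f) {s u : ℝ} (hs : 0 < s) (hu : 0 < u) :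
    f s + deriv f s * (u - s) ≤ f u := by
  have hc := hf.strictConvex.convexOn
  rcases lt_trichotomy s u with h | rfl | h
  · have := hc.le_slope_of_hasDerivAt hs hu h (hf.hasDerivAt hs)
    rw [slope_def_field, le_div_iff₀ (by linarith)] at this
    linarith
  · simp
  · have := hc.slope_le_of_hasDerivAt hu hs h (hf.hasDerivAt hs)
    rw [slope_def_field, div_le_iff₀ (by linarith)] at this
    linarith

/-- The Fenchel–Young equality: the supremum is attained at the point of tangency. -/
lemma fenchelConjugate_deriv (hf : IsGenerator f) {s : ℝ} (hs : 0 < s) :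
    fenchelConjugate f (deriv f s) = deriv f s * s - f s := by
  refine IsGreatest.csSup_eq ⟨⟨s, hs, rfl⟩, ?_⟩
  rintro _ ⟨u, hu, rfl⟩
  have := hf.tangent_le hs (mem_Ioi.1 hu)
  dsimp only
  linarith

end IsGenerator

namespace FEBM

variable {𝒳 : Type*} [MeasurableSpace 𝒳] {m n : ℕ} (M : FEBM 𝒳 m n)

/-- The derivative of `A`. -/
def A' (u : ℝ) : ℝ := Real.exp u * deriv (deriv M.f) (Real.exp u)

variable {M}

lemma hasDerivAt_A (hf : IsGenerator M.f) (u : ℝ) : HasDerivAt M.A (M.A' u) u := by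
  have h := (hf.hasDerivAt_deriv (Real.exp_pos u)).comp u (Real.hasDerivAt_exp u)
  rw [mul_comm] at h
  exact h

lemma differentiable_A' (hf : IsGenerator M.f) : Differentiable ℝ M.A' := fun u =>
  Real.differentiableAt_exp.mul
    ((hf.diff₃.differentiableAt (Ioi_mem_nhds (Real.exp_pos u))).comp u Real.differentiableAt_exp)

lemma B_eq (hf : IsGenerator M.f) (u : ℝ) :
    M.B u = deriv M.f (Real.exp u) * Real.exp u - M.f (Real.exp u) - deriv M.f 1 := by
  rw [B, hf.fenchelConjugate_deriv (Real.exp_pos u), hf.fenchelConjugate_deriv one_pos,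
    hf.map_one]
  ring

lemma hasDerivAt_B (hf : IsGenerator M.f) (u : ℝ) :
    HasDerivAt M.B (Real.exp u * M.A' u) u := by
  have hexp := Real.hasDerivAt_exp u
  have h := (((hasDerivAt_A hf u).mul hexp).sub
    ((hf.hasDerivAt (Real.exp_pos u)).comp u hexp)).sub_const (deriv M.f 1)
  have hB : M.B = fun u => M.A u * Real.exp u - (M.f ∘ Real.exp) u - deriv M.f 1 :=
    funext fun u => B_eq hf u
  rw [hB]
  refine h.congr_deriv ?_
  rw [A]
  ring

lemma B_zero : M.B 0 = 0 := by simp [B]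

lemma A'_zero : M.A' 0 = deriv (deriv M.f) 1 := by simp [A']

end FEBM

end Generators

/-! ### Derivatives of the integrands in the parameters -/

section Integrands

variable {W : Type*} [NormedAddCommGroup W] [NormedSpace ℝ W]

lemma TwiceDifferentiableOn.of_hasFDerivAt {g : W → ℝ} {g' : W → W →L[ℝ] ℝ} {U : Set W}
    (hU : IsOpen U) (h : ∀ w ∈ U, HasFDerivAt g (g' w) w)
    (h' : ∀ w ∈ U, DifferentiableAt ℝ g' w) : TwiceDifferentiableOn g U :=
  ⟨fun w hw => (h w hw).differentiableAt.differentiableWithinAt, fun w hw =>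
    ((h' w hw).congr_of_eventuallyEq (Filter.mem_of_superset (hU.mem_nhds hw)
      fun w' hw' => (h w' hw').fderiv)).differentiableWithinAt⟩

lemma TwiceDifferentiableOn.comp_clm {W' : Type*} [NormedAddCommGroup W'] [NormedSpace ℝ W']
    {g : W → ℝ} {U : Set W} (hU : IsOpen U) (hg : TwiceDifferentiableOn g U) (L : W' →L[ℝ] W) :
    TwiceDifferentiableOn (fun w => g (L w)) (L ⁻¹' U) := by
  refine .of_hasFDerivAt (g' := fun w => (fderiv ℝ g (L w)).comp L) (hU.preimage L.continuous)
    (fun w hw => (hg.1.differentiableAt (hU.mem_nhds hw)).hasFDerivAt.comp w L.hasFDerivAt)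
    fun w hw => ?_
  exact ((ContinuousLinearMap.compL ℝ W' W ℝ).flip L).differentiableAt.comp w
    ((hg.2.differentiableAt (hU.mem_nhds hw)).comp w L.differentiableAt)

lemma TwiceDifferentiableOn.mono {g : W → ℝ} {U U' : Set W} (hg : TwiceDifferentiableOn g U)
    (h : U' ⊆ U) : TwiceDifferentiableOn g U' :=
  ⟨hg.1.mono h, hg.2.mono h⟩

variable {e η : W → ℝ} {U : Set W} {A A' B : ℝ → ℝ}

lemma TwiceDifferentiableOn.hasFDerivAt {g : W → ℝ} (hg : TwiceDifferentiableOn g U)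
    (hU : IsOpen U) {w : W} (hw : w ∈ U) : HasFDerivAt g (fderiv ℝ g w) w :=
  (hg.1.differentiableAt (hU.mem_nhds hw)).hasFDerivAt

lemma TwiceDifferentiableOn.differentiableAt_fderiv {g : W → ℝ} (hg : TwiceDifferentiableOn g U)
    (hU : IsOpen U) {w : W} (hw : w ∈ U) : DifferentiableAt ℝ (fderiv ℝ g) w :=
  hg.2.differentiableAt (hU.mem_nhds hw)

lemma hasFDerivAt_exp_neg (hU : IsOpen U) (he : TwiceDifferentiableOn e U) {w : W} (hw : w ∈ U) :
    HasFDerivAt (fun w => Real.exp (-e w)) (-Real.exp (-e w) • fderiv ℝ e w) w := by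
  have h := ((he.hasFDerivAt hU hw).neg).exp
  simpa using h

lemma twiceDifferentiableOn_exp_neg (hU : IsOpen U) (he : TwiceDifferentiableOn e U) :
    TwiceDifferentiableOn (fun w => Real.exp (-e w)) U :=
  .of_hasFDerivAt hU (fun _ hw => hasFDerivAt_exp_neg hU he hw) fun _ hw =>
    (hasFDerivAt_exp_neg hU he hw).differentiableAt.neg.smul (he.differentiableAt_fderiv hU hw)

lemma hasFDerivAt_mul_A (hU : IsOpen U) (he : TwiceDifferentiableOn e U)
    (hη : TwiceDifferentiableOn η U) (hA : ∀ t, HasDerivAt A (A' t) t) (p : ℝ) {w : W}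
    (hw : w ∈ U) :
    HasFDerivAt (fun w => p * A (η w + e w))
      ((p * A' (η w + e w)) • (fderiv ℝ η w + fderiv ℝ e w)) w := by
  have h := ((hA (η w + e w)).comp_hasFDerivAt w
    ((hη.hasFDerivAt hU hw).add (he.hasFDerivAt hU hw))).const_mul p
  rw [smul_smul] at h
  exact h

lemma twiceDifferentiableOn_mul_A (hU : IsOpen U) (he : TwiceDifferentiableOn e U)
    (hη : TwiceDifferentiableOn η U) (hA : ∀ t, HasDerivAt A (A' t) t) (hA' : Differentiable ℝ A')
    (p : ℝ) : TwiceDifferentiableOn (fun w => p * A (η w + e w)) U :=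
  .of_hasFDerivAt hU (fun _ hw => hasFDerivAt_mul_A hU he hη hA p hw) fun w hw =>
    (((hA' _).comp w ((hη.hasFDerivAt hU hw).differentiableAt.add
      (he.hasFDerivAt hU hw).differentiableAt)).const_mul p).smul
      ((hη.differentiableAt_fderiv hU hw).add (he.differentiableAt_fderiv hU hw))

/-- Because `B' = exp · A'`, the weight `exp (-e)` cancels in the main term. -/
lemma hasFDerivAt_exp_neg_mul_B (hU : IsOpen U) (he : TwiceDifferentiableOn e U)
    (hη : TwiceDifferentiableOn η U) (hB : ∀ t, HasDerivAt B (Real.exp t * A' t) t) {w : W}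
    (hw : w ∈ U) :
    HasFDerivAt (fun w => Real.exp (-e w) * B (η w + e w))
      ((Real.exp (η w) * A' (η w + e w)) • (fderiv ℝ η w + fderiv ℝ e w) -
        (Real.exp (-e w) * B (η w + e w)) • fderiv ℝ e w) w := by
  have h := (hasFDerivAt_exp_neg hU he hw).mul ((hB (η w + e w)).comp_hasFDerivAt w
    ((hη.hasFDerivAt hU hw).add (he.hasFDerivAt hU hw)))
  refine h.congr_fderiv ?_
  have h1 : Real.exp (η w) = Real.exp (-e w) * Real.exp (η w + e w) := by
    rw [← Real.exp_add]; ring_nf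
  rw [h1]
  ext v
  simp
  ring

lemma twiceDifferentiableOn_exp_neg_mul_B (hU : IsOpen U) (he : TwiceDifferentiableOn e U)
    (hη : TwiceDifferentiableOn η U) (hA' : Differentiable ℝ A')
    (hB : ∀ t, HasDerivAt B (Real.exp t * A' t) t) :
    TwiceDifferentiableOn (fun w => Real.exp (-e w) * B (η w + e w)) U :=
  .of_hasFDerivAt hU (fun _ hw => hasFDerivAt_exp_neg_mul_B hU he hη hB hw) fun w hw => by
    have d1 := (hη.hasFDerivAt hU hw).differentiableAt
    have d2 := (he.hasFDerivAt hU hw).differentiableAt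
    exact ((d1.exp.mul ((hA' _).comp w (d1.add d2))).smul
      ((hη.differentiableAt_fderiv hU hw).add (he.differentiableAt_fderiv hU hw))).sub
      ((hasFDerivAt_exp_neg_mul_B hU he hη hB hw).differentiableAt.smul
        (he.differentiableAt_fderiv hU hw))

/-- At a realizable point the second derivatives of `e` and `η` cancel in the difference of the two
integrands of the objective: both coefficients of the first derivative vanish there. -/
lemma fderiv_fderiv_sub_apply (hU : IsOpen U) (he : TwiceDifferentiableOn e U)
    (hη : TwiceDifferentiableOn η U) (hA : ∀ t, HasDerivAt A (A' t) t) (hA' : Differentiable ℝ A')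
    (hB : ∀ t, HasDerivAt B (Real.exp t * A' t) t) (hB0 : B 0 = 0) {w : W} (hw : w ∈ U)
    (h0 : η w + e w = 0) {p Z : ℝ} (hp : p = Z⁻¹ * Real.exp (-e w)) (v v' : W) :
    fderiv ℝ (fderiv ℝ fun w => p * A (η w + e w)) w v v' -
      Z⁻¹ * fderiv ℝ (fderiv ℝ fun w => Real.exp (-e w) * B (η w + e w)) w v v' =
    p * A' 0 * (fderiv ℝ e w v * fderiv ℝ e w v' - fderiv ℝ η w v * fderiv ℝ η w v') := by
  have d1 := hη.hasFDerivAt hU hw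
  have d2 := he.hasFDerivAt hU hw
  have hη0 : η w = -e w := by linarith
  have key : HasFDerivAt (fun w => ((p - Z⁻¹ * Real.exp (η w)) * A' (η w + e w)) •
        (fderiv ℝ η w + fderiv ℝ e w) + (Z⁻¹ * (Real.exp (-e w) * B (η w + e w))) • fderiv ℝ e w)
      ((-(p * A' 0) • fderiv ℝ η w).smulRight (fderiv ℝ η w + fderiv ℝ e w) +
        ((p * A' 0) • (fderiv ℝ η w + fderiv ℝ e w)).smulRight (fderiv ℝ e w)) w := by
    have c1 := ((d1.exp.const_mul Z⁻¹).const_sub p).mul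
      ((hA' (η w + e w)).hasDerivAt.comp_hasFDerivAt w (d1.add d2))
    have c2 := (hasFDerivAt_exp_neg_mul_B hU he hη hB hw).const_mul Z⁻¹
    refine ((c1.smul ((hη.differentiableAt_fderiv hU hw).add
      (he.differentiableAt_fderiv hU hw)).hasFDerivAt).add
      (c2.smul (he.differentiableAt_fderiv hU hw).hasFDerivAt)).congr_fderiv ?_
    ext a b
    simp only [Function.comp_apply, Pi.add_apply, h0, hB0]
    simp [hη0, hp]
    ring
  have dA := (twiceDifferentiableOn_mul_A hU he hη hA hA' p).differentiableAt_fderiv hU hw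
  have dB := (twiceDifferentiableOn_exp_neg_mul_B hU he hη hA' hB).differentiableAt_fderiv hU hw
  have hd := (dA.hasFDerivAt.sub (dB.hasFDerivAt.const_smul Z⁻¹)).unique
    (key.congr_of_eventuallyEq (Filter.mem_of_superset (hU.mem_nhds hw) fun w' hw' => by
      simp only [mem_ofPred_eq, Pi.sub_apply, Pi.smul_apply]
      rw [(hasFDerivAt_mul_A hU he hη hA p hw').fderiv,
        (hasFDerivAt_exp_neg_mul_B hU he hη hB hw').fderiv]
      ext a
      simp
      ring))
  have := congrArg (fun L : W →L[ℝ] W →L[ℝ] ℝ => L v v') hd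
  simp at this
  rw [this]
  ring

end Integrands

/-! ### The objective near a realizable point -/

section Objective

namespace FEBM

variable {𝒳 : Type*} [MeasurableSpace 𝒳] {m n : ℕ} {M : FEBM 𝒳 m n}
  {θ₀ : EuclideanSpace ℝ (Fin m)} {ω₀ : EuclideanSpace ℝ (Fin n)}

lemma measurable_A : Measurable M.A := (measurable_deriv M.f).comp Real.measurable_exp

lemma measurable_B (hf : IsGenerator M.f) : Measurable M.B :=
  (continuous_iff_continuousAt.2 fun u => (hasDerivAt_B hf u).continuousAt).measurable

lemma Regular.leibniz_exp (hreg : M.Regular θ₀ ω₀) :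
    Integrable (fun x => Real.exp (-M.E θ₀ x)) M.base ∧
    (∀ v, fderiv ℝ M.Z θ₀ v =
      ∫ x, -Real.exp (-M.E θ₀ x) * fderiv ℝ (fun θ => M.E θ x) θ₀ v ∂M.base) ∧
    HasTwoBoundedFDerivNear M.Z θ₀ := by
  obtain ⟨U, hU, h0, hE⟩ := hreg.E_diff
  obtain ⟨h1, -, h2, -, h3⟩ := hreg.dom_exp.leibniz hU h0
    (fun x => twiceDifferentiableOn_exp_neg hU (hE x))
    (fun θ => (hreg.E_measurable θ).neg.exp.aestronglyMeasurable)
  refine ⟨h1, fun v => ?_, h3⟩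
  refine (h2 v).trans (integral_congr_ae (ae_of_all _ fun x => ?_))
  simp [(hasFDerivAt_exp_neg hU (hE x) h0).fderiv]

lemma Regular.exists_twiceDifferentiableOn (hreg : M.Regular θ₀ ω₀) :
    ∃ U : Set (EuclideanSpace ℝ (Fin m) × EuclideanSpace ℝ (Fin n)), IsOpen U ∧ (θ₀, ω₀) ∈ U ∧
      ∀ x, TwiceDifferentiableOn (fun z => M.E z.1 x) U ∧
        TwiceDifferentiableOn (fun z => M.H z.2 x) U ∧
        (∀ v, fderiv ℝ (fun z : EuclideanSpace ℝ (Fin m) × EuclideanSpace ℝ (Fin n) =>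
          M.E z.1 x) (θ₀, ω₀) v = fderiv ℝ (fun θ => M.E θ x) θ₀ v.1) ∧
        (∀ v, fderiv ℝ (fun z : EuclideanSpace ℝ (Fin m) × EuclideanSpace ℝ (Fin n) =>
          M.H z.2 x) (θ₀, ω₀) v = fderiv ℝ (fun ω => M.H ω x) ω₀ v.2) := by
  obtain ⟨U, hU, h0, hE⟩ := hreg.E_diff
  obtain ⟨U', hU', h0', hH⟩ := hreg.H_diff
  refine ⟨U ×ˢ U', hU.prod hU', ⟨h0, h0'⟩, fun x => ⟨?_, ?_, fun v => ?_, fun v => ?_⟩⟩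
  · exact ((hE x).comp_clm hU (ContinuousLinearMap.fst ℝ (EuclideanSpace ℝ (Fin m))
      (EuclideanSpace ℝ (Fin n)))).mono fun z hz => hz.1
  · exact ((hH x).comp_clm hU' (ContinuousLinearMap.snd ℝ (EuclideanSpace ℝ (Fin m))
      (EuclideanSpace ℝ (Fin n)))).mono fun z hz => hz.2
  · have h := HasFDerivAt.comp (f := Prod.fst) (g := fun θ => M.E θ x) (θ₀, ω₀)
      ((hE x).hasFDerivAt hU h0) hasFDerivAt_fst
    have h' := h.fderiv
    simp only [Function.comp_def] at h'
    rw [h']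
    rfl
  · have h := HasFDerivAt.comp (f := Prod.snd) (g := fun ω => M.H ω x) (θ₀, ω₀)
      ((hH x).hasFDerivAt hU' h0') hasFDerivAt_snd
    have h' := h.fderiv
    simp only [Function.comp_def] at h'
    rw [h']
    rfl

/-- At a realizable point, `q = p` everywhere on the support of `p`; as both are probability
densities and `q > 0`, the complement of the support is a null set. -/
lemma Regular.Z_pos_and_ae (hreg : M.Regular θ₀ ω₀) (hreal : M.Realizable θ₀ ω₀) :
    0 < M.Z θ₀ ∧ ∀ᵐ x ∂M.base, M.p x = (M.Z θ₀)⁻¹ * Real.exp (-M.E θ₀ x) ∧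
      M.H ω₀ x + M.E θ₀ x = 0 := by
  have hZ0 : 0 ≤ M.Z θ₀ := integral_nonneg fun x => (Real.exp_pos _).le
  have hZ : 0 < M.Z θ₀ := by
    refine lt_of_le_of_ne hZ0 fun h => ?_
    -- division by `Z = 0` would make `q`, and with it `p`, vanish identically
    have hp : ∀ x, M.p x = 0 := fun x => by
      by_contra hx
      have := (hreal x hx).1
      rw [q, ← h, div_zero] at this
      exact hx this.symm
    have h1 := hreg.p_integral
    simp [hp] at h1
  have hq : Integrable (M.q θ₀) M.base := hreg.leibniz_exp.1.div_const _
  have hq1 : ∫ x, M.q θ₀ x ∂M.base = 1 := by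
    have : ∫ x, M.q θ₀ x ∂M.base = M.Z θ₀ / M.Z θ₀ := integral_div _ _
    rw [this, div_self hZ.ne']
  have hqpos : ∀ x, 0 < M.q θ₀ x := fun x => div_pos (Real.exp_pos _) hZ
  -- a function with nonzero Bochner integral is integrable
  have hp : Integrable M.p M.base := by
    by_contra h
    have := hreg.p_integral
    rw [integral_undef h] at this
    exact zero_ne_one this
  have hae : M.q θ₀ - M.p =ᵐ[M.base] 0 := by
    refine (integral_eq_zero_iff_of_nonneg (fun x => ?_) (hq.sub hp)).1 (by
      rw [integral_sub' hq hp, hq1, hreg.p_integral, sub_self])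
    by_cases hx : M.p x = 0
    · simpa [hx] using (hqpos x).le
    · simp [(hreal x hx).1]
  refine ⟨hZ, hae.mono fun x hx => ?_⟩
  have hpq : M.q θ₀ x = M.p x := sub_eq_zero.1 hx
  have hpx : M.p x = (M.Z θ₀)⁻¹ * Real.exp (-M.E θ₀ x) := by
    rw [← hpq, q, div_eq_inv_mul]
  refine ⟨hpx, ?_⟩
  have hne : M.p x ≠ 0 := hpq ▸ (hqpos x).ne'
  rw [(hreal x hne).2, hpx, mul_right_comm, inv_mul_cancel₀ hZ.ne', one_mul, Real.log_exp]
  ring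

/-- The objective near a realizable point: it is twice differentiable with bounded derivatives, its
gradient vanishes, and its second derivative contains only first derivatives of `E` and `H`. -/
lemma Regular.objective (hreg : M.Regular θ₀ ω₀) (hreal : M.Realizable θ₀ ω₀) :
    HasTwoBoundedFDerivNear (fun z : EuclideanSpace ℝ (Fin m) × EuclideanSpace ℝ (Fin n) =>
      M.V z.1 z.2) (θ₀, ω₀) ∧
    fderiv ℝ (fun z : EuclideanSpace ℝ (Fin m) × EuclideanSpace ℝ (Fin n) =>
      M.V z.1 z.2) (θ₀, ω₀) = 0 ∧
    (∀ v v' : EuclideanSpace ℝ (Fin m) × EuclideanSpace ℝ (Fin n),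
      Integrable (fun x => M.p x *
        (fderiv ℝ (fun θ => M.E θ x) θ₀ v.1 * fderiv ℝ (fun θ => M.E θ x) θ₀ v'.1 -
          fderiv ℝ (fun ω => M.H ω x) ω₀ v.2 * fderiv ℝ (fun ω => M.H ω x) ω₀ v'.2)) M.base) ∧
    ∀ v v' : EuclideanSpace ℝ (Fin m) × EuclideanSpace ℝ (Fin n),
      fderiv ℝ (fderiv ℝ fun z : EuclideanSpace ℝ (Fin m) × EuclideanSpace ℝ (Fin n) =>
        M.V z.1 z.2) (θ₀, ω₀) v v' = deriv (deriv M.f) 1 *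
      (M.expect (fun x =>
        fderiv ℝ (fun θ => M.E θ x) θ₀ v.1 * fderiv ℝ (fun θ => M.E θ x) θ₀ v'.1 -
          fderiv ℝ (fun ω => M.H ω x) ω₀ v.2 * fderiv ℝ (fun ω => M.H ω x) ω₀ v'.2) -
        M.expect (fun x => fderiv ℝ (fun θ => M.E θ x) θ₀ v.1) *
          M.expect (fun x => fderiv ℝ (fun ω => M.H ω x) ω₀ v'.2 +
            fderiv ℝ (fun θ => M.E θ x) θ₀ v'.1) -
        M.expect (fun x => fderiv ℝ (fun ω => M.H ω x) ω₀ v.2 +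
            fderiv ℝ (fun θ => M.E θ x) θ₀ v.1) *
          M.expect (fun x => fderiv ℝ (fun θ => M.E θ x) θ₀ v'.1)) := by
  obtain ⟨hZ, hae⟩ := hreg.Z_pos_and_ae hreal
  obtain ⟨U, hU, h0, hEH⟩ := hreg.exists_twiceDifferentiableOn
  have hf := hreg.generator
  have hA := hasDerivAt_A hf
  have hA' := differentiable_A' hf
  have hB := hasDerivAt_B hf
  set k := deriv (deriv M.f) 1 with hk
  have hk0 : 0 < k := hf.second_pos
  have hA0 : M.A' 0 = k := A'_zero
  have hmeasu : ∀ z : EuclideanSpace ℝ (Fin m) × EuclideanSpace ℝ (Fin n),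
      Measurable fun x => M.H z.2 x + M.E z.1 x := fun z =>
    (hreg.H_measurable z.2).add (hreg.E_measurable z.1)
  obtain ⟨-, iA, dA, ddA, rA⟩ := hreg.dom_A.leibniz hU h0
    (fun x => twiceDifferentiableOn_mul_A hU (hEH x).1 (hEH x).2.1 hA hA' (M.p x))
    (fun z => (hreg.p_measurable.mul (measurable_A.comp (hmeasu z))).aestronglyMeasurable)
  obtain ⟨-, iB, dB, ddB, rB⟩ := hreg.dom_B.leibniz hU h0
    (fun x => twiceDifferentiableOn_exp_neg_mul_B hU (hEH x).1 (hEH x).2.1 hA' hB)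
    (fun z => ((hreg.E_measurable z.1).neg.exp.mul
      ((measurable_B hf).comp (hmeasu z))).aestronglyMeasurable)
  obtain ⟨-, dZ, rZ⟩ := hreg.leibniz_exp
  set IA : EuclideanSpace ℝ (Fin m) × EuclideanSpace ℝ (Fin n) → ℝ :=
    fun z => ∫ x, M.p x * M.A (M.H z.2 x + M.E z.1 x) ∂M.base with hIA
  set IB : EuclideanSpace ℝ (Fin m) × EuclideanSpace ℝ (Fin n) → ℝ :=
    fun z => ∫ x, Real.exp (-M.E z.1 x) * M.B (M.H z.2 x + M.E z.1 x) ∂M.base with hIB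
  set ζ : EuclideanSpace ℝ (Fin m) × EuclideanSpace ℝ (Fin n) → ℝ :=
    fun z => (M.Z z.1)⁻¹ with hζ
  have rZ' : HasTwoBoundedFDerivNear
      (fun z : EuclideanSpace ℝ (Fin m) × EuclideanSpace ℝ (Fin n) => M.Z z.1) (θ₀, ω₀) :=
    HasTwoBoundedFDerivNear.comp_clm (w₁ := (θ₀, ω₀)) (ContinuousLinearMap.fst ℝ _ _) rZ
  have rζ : HasTwoBoundedFDerivNear ζ (θ₀, ω₀) := rZ'.inv hZ.ne'
  have hV : (fun z : EuclideanSpace ℝ (Fin m) × EuclideanSpace ℝ (Fin n) => M.V z.1 z.2) =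
      fun z => IA z - ζ z * IB z := by
    funext z
    simp only [V, hIA, hIB, hζ]
    congr 1
    rw [← integral_const_mul]
    congr 1
    funext x
    rw [q]
    ring
  have hIB0 : IB (θ₀, ω₀) = 0 := by
    refine integral_eq_zero_of_ae (hae.mono fun x hx => ?_)
    simp only [hx.2, B_zero, mul_zero, Pi.zero_apply]
  have hexpE : ∀ᵐ x ∂M.base, Real.exp (-M.E θ₀ x) = M.Z θ₀ * M.p x := hae.mono fun x hx => by
    rw [hx.1, mul_inv_cancel_left₀ hZ.ne']
  have hexpH : ∀ᵐ x ∂M.base, Real.exp (M.H ω₀ x) = M.Z θ₀ * M.p x := by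
    filter_upwards [hae, hexpE] with x hx hx'
    rw [← hx', show M.H ω₀ x = -M.E θ₀ x by linarith [hx.2]]
  have dA' : ∀ v, fderiv ℝ IA (θ₀, ω₀) v = k * M.expect (fun x =>
      fderiv ℝ (fun ω => M.H ω x) ω₀ v.2 + fderiv ℝ (fun θ => M.E θ x) θ₀ v.1) := by
    intro v
    rw [dA, expect, ← integral_const_mul]
    refine integral_congr_ae (hae.mono fun x hx => ?_)
    simp only
    rw [(hasFDerivAt_mul_A hU (hEH x).1 (hEH x).2.1 hA (M.p x) h0).fderiv]
    simp only [hx.2, hA0, _root_.smul_apply, _root_.add_apply, smul_eq_mul, (hEH x).2.2.1,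
      (hEH x).2.2.2]
    ring
  have dB' : ∀ v, fderiv ℝ IB (θ₀, ω₀) v = M.Z θ₀ * k * M.expect (fun x =>
      fderiv ℝ (fun ω => M.H ω x) ω₀ v.2 + fderiv ℝ (fun θ => M.E θ x) θ₀ v.1) := by
    intro v
    rw [dB, expect, ← integral_const_mul]
    refine integral_congr_ae ?_
    filter_upwards [hae, hexpH] with x hx hx'
    rw [(hasFDerivAt_exp_neg_mul_B hU (hEH x).1 (hEH x).2.1 hB h0).fderiv]
    simp only [hx.2, hA0, hx', B_zero, mul_zero, zero_smul, sub_zero, _root_.smul_apply,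
      _root_.add_apply, smul_eq_mul, (hEH x).2.2.1, (hEH x).2.2.2]
    ring
  have dζ : ∀ v, fderiv ℝ ζ (θ₀, ω₀) v =
      (M.Z θ₀)⁻¹ * M.expect (fun x => fderiv ℝ (fun θ => M.E θ x) θ₀ v.1) := by
    intro v
    have h1 : HasFDerivAt ζ (-(M.Z θ₀ ^ 2)⁻¹ •
        (fderiv ℝ M.Z θ₀).comp (ContinuousLinearMap.fst ℝ _ _)) (θ₀, ω₀) :=
      HasDerivAt.comp_hasFDerivAt (f := fun z : EuclideanSpace ℝ (Fin m) ×
        EuclideanSpace ℝ (Fin n) => M.Z z.1) (θ₀, ω₀) (hasDerivAt_inv hZ.ne')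
        (HasFDerivAt.comp (f := Prod.fst) (θ₀, ω₀) rZ.first.differentiableAt.hasFDerivAt
          hasFDerivAt_fst)
    have h2 : fderiv ℝ M.Z θ₀ v.1 =
        -M.Z θ₀ * M.expect (fun x => fderiv ℝ (fun θ => M.E θ x) θ₀ v.1) := by
      rw [dZ, expect, ← integral_const_mul]
      refine integral_congr_ae (hexpE.mono fun x hx => ?_)
      simp only [hx]
      ring
    rw [h1.fderiv]
    simp only [_root_.smul_apply, ContinuousLinearMap.comp_apply, ContinuousLinearMap.coe_fst',
      smul_eq_mul, h2]
    field_simp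
  -- the two integrands of the objective have integrable second derivatives only in combination
  have hcomb : ∀ v v' : EuclideanSpace ℝ (Fin m) × EuclideanSpace ℝ (Fin n), ∀ᵐ x ∂M.base,
      fderiv ℝ (fderiv ℝ fun z : EuclideanSpace ℝ (Fin m) × EuclideanSpace ℝ (Fin n) =>
        M.p x * M.A (M.H z.2 x + M.E z.1 x)) (θ₀, ω₀) v v' - (M.Z θ₀)⁻¹ *
      fderiv ℝ (fderiv ℝ fun z : EuclideanSpace ℝ (Fin m) × EuclideanSpace ℝ (Fin n) =>
        Real.exp (-M.E z.1 x) * M.B (M.H z.2 x + M.E z.1 x)) (θ₀, ω₀) v v' =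
      k * (M.p x *
        (fderiv ℝ (fun θ => M.E θ x) θ₀ v.1 * fderiv ℝ (fun θ => M.E θ x) θ₀ v'.1 -
          fderiv ℝ (fun ω => M.H ω x) ω₀ v.2 * fderiv ℝ (fun ω => M.H ω x) ω₀ v'.2)) := by
    intro v v'
    filter_upwards [hae] with x hx
    rw [fderiv_fderiv_sub_apply hU (hEH x).1 (hEH x).2.1 hA hA' hB B_zero h0 hx.2 hx.1, hA0]
    simp only [(hEH x).2.2.1, (hEH x).2.2.2]
    ring
  refine ⟨?_, ?_, fun v v' => ?_, fun v v' => ?_⟩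
  · rw [hV]
    exact rA.sub (rζ.mul rB)
  · rw [hV, (rA.fderiv_sub_mul_eventuallyEq rζ rB).self_of_nhds]
    ext v <;>
    · simp only [ContinuousLinearMap.comp_apply, _root_.sub_apply, _root_.smul_apply,
        hIB0, zero_smul, add_zero, dA', dB', smul_eq_mul, hζ,
        _root_.zero_apply]
      rw [mul_assoc, inv_mul_cancel_left₀ hZ.ne', sub_self]
  · have h1 := ((iA v v').sub ((iB v v').const_mul (M.Z θ₀)⁻¹)).congr (hcomb v v')
    simpa [hk0.ne'] using h1.const_mul k⁻¹
  · rw [hV, rA.fderiv_fderiv_sub_mul rζ rB, hIB0, zero_mul, zero_add, dζ, dζ, dB', dB']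
    have h2 : fderiv ℝ (fderiv ℝ IA) (θ₀, ω₀) v v' -
        ζ (θ₀, ω₀) * fderiv ℝ (fderiv ℝ IB) (θ₀, ω₀) v v' = k * M.expect (fun x =>
        fderiv ℝ (fun θ => M.E θ x) θ₀ v.1 * fderiv ℝ (fun θ => M.E θ x) θ₀ v'.1 -
          fderiv ℝ (fun ω => M.H ω x) ω₀ v.2 * fderiv ℝ (fun ω => M.H ω x) ω₀ v'.2) := by
      rw [ddA, ddB, hζ, expect, ← integral_const_mul, ← integral_const_mul,
        ← integral_sub (iA v v') ((iB v v').const_mul _)]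
      exact integral_congr_ae (hcomb v v')
    rw [← sub_sub, ← sub_sub, h2]
    field_simp

end FEBM

end Objective

/-! ### The gradient field and its Jacobian -/

section Jacobian

/-- The coordinates of the gradient are the partial derivatives. -/
lemma gradient_apply {d : ℕ} (g : EuclideanSpace ℝ (Fin d) → ℝ) (x : EuclideanSpace ℝ (Fin d))
    (i : Fin d) : gradient g x i = fderiv ℝ g x (EuclideanSpace.single i 1) := by
  have h : inner ℝ (gradient g x) (EuclideanSpace.single i 1) =
      fderiv ℝ g x (EuclideanSpace.single i 1) := by
    rw [gradient, InnerProductSpace.toDual_symm_apply]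
  rw [← h, EuclideanSpace.inner_single_right]
  simp

/-- The gradient in the second factor and the negative gradient in the first factor, as a linear
function of the derivative. -/
def saddleGradient (m n : ℕ) :
    ((EuclideanSpace ℝ (Fin m) × EuclideanSpace ℝ (Fin n)) →L[ℝ] ℝ) →L[ℝ]
      EuclideanSpace ℝ (Fin m) × EuclideanSpace ℝ (Fin n) :=
  LinearMap.toContinuousLinearMap
    { toFun := fun φ => (WithLp.toLp 2 fun i => -φ (EuclideanSpace.single i 1, 0),
        WithLp.toLp 2 fun j => φ (0, EuclideanSpace.single j 1))
      map_add' := fun φ ψ => by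
        refine Prod.ext ?_ ?_ <;> ext i
        · exact neg_add (φ _) (ψ _)
        · rfl
      map_smul' := fun c φ => by
        refine Prod.ext ?_ ?_ <;> ext i
        · exact (mul_neg c (φ _)).symm
        · rfl }

lemma saddleGradient_fst_apply {m n : ℕ}
    (φ : (EuclideanSpace ℝ (Fin m) × EuclideanSpace ℝ (Fin n)) →L[ℝ] ℝ) (i : Fin m) :
    (saddleGradient m n φ).1 i = -φ (EuclideanSpace.single i 1, 0) := rfl

lemma saddleGradient_snd_apply {m n : ℕ}
    (φ : (EuclideanSpace ℝ (Fin m) × EuclideanSpace ℝ (Fin n)) →L[ℝ] ℝ) (j : Fin n) :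
    (saddleGradient m n φ).2 j = φ (0, EuclideanSpace.single j 1) := rfl

namespace FEBM

variable {𝒳 : Type*} [MeasurableSpace 𝒳] {m n : ℕ} {M : FEBM 𝒳 m n}
  {θ₀ : EuclideanSpace ℝ (Fin m)} {ω₀ : EuclideanSpace ℝ (Fin n)}

lemma field_eq_saddleGradient {z : EuclideanSpace ℝ (Fin m) × EuclideanSpace ℝ (Fin n)}
    (h : DifferentiableAt ℝ (fun z : EuclideanSpace ℝ (Fin m) × EuclideanSpace ℝ (Fin n) =>
      M.V z.1 z.2) z) :
    M.field z = saddleGradient m n (fderiv ℝ (fun z : EuclideanSpace ℝ (Fin m) ×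
      EuclideanSpace ℝ (Fin n) => M.V z.1 z.2) z) := by
  have h1 : HasFDerivAt (fun θ => M.V θ z.2) _ z.1 :=
    HasFDerivAt.comp (f := fun θ => (θ, z.2)) (g := fun z => M.V z.1 z.2) z.1
      h.hasFDerivAt
      (hasFDerivAt_prodMk_left z.1 z.2)
  have h2 : HasFDerivAt (fun ω => M.V z.1 ω) _ z.2 :=
    HasFDerivAt.comp (f := fun ω => (z.1, ω)) (g := fun z => M.V z.1 z.2) z.2
      h.hasFDerivAt
      (hasFDerivAt_prodMk_right z.1 z.2)
  refine Prod.ext ?_ ?_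
  · ext i
    rw [saddleGradient_fst_apply, field]
    simp only [PiLp.neg_apply, gradient_apply, h1.fderiv]
    rfl
  · ext j
    rw [saddleGradient_snd_apply, field]
    simp only [gradient_apply, h2.fderiv]
    rfl

/-- The field is differentiable at a realizable point, where it vanishes, and Lipschitz near it. -/
lemma Regular.field_props (hreg : M.Regular θ₀ ω₀) (hreal : M.Realizable θ₀ ω₀) :
    M.field (θ₀, ω₀) = 0 ∧ HasBoundedFDerivNear M.field (θ₀, ω₀) ∧
    ∀ v, fderiv ℝ M.field (θ₀, ω₀) v = saddleGradient m n
      (fderiv ℝ (fderiv ℝ fun z : EuclideanSpace ℝ (Fin m) × EuclideanSpace ℝ (Fin n) =>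
        M.V z.1 z.2) (θ₀, ω₀) v) := by
  obtain ⟨hV, hV0, -, -⟩ := hreg.objective hreal
  have heq : M.field =ᶠ[𝓝 (θ₀, ω₀)] fun z => saddleGradient m n (fderiv ℝ
      (fun z : EuclideanSpace ℝ (Fin m) × EuclideanSpace ℝ (Fin n) => M.V z.1 z.2) z) :=
    hV.first.1.mono fun z hz => field_eq_saddleGradient hz
  refine ⟨?_, (hV.second.clm_comp (saddleGradient m n)).congr heq, fun v => ?_⟩
  · rw [heq.self_of_nhds]
    simp only [hV0, map_zero]
  · rw [(((saddleGradient m n).hasFDerivAt.comp (θ₀, ω₀)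
      hV.second.differentiableAt.hasFDerivAt).congr_of_eventuallyEq heq).fderiv]
    rfl

lemma Regular.jacobian_eq (hreg : M.Regular θ₀ ω₀) (hreal : M.Realizable θ₀ ω₀) :
    M.jacobian (θ₀, ω₀) = deriv (deriv M.f) 1 •
      Matrix.fromBlocks (-M.KEE θ₀) (M.KEH θ₀ ω₀) (-(M.KEH θ₀ ω₀).transpose) (-M.KHH ω₀) := by
  obtain ⟨-, -, hJ⟩ := hreg.field_props hreal
  obtain ⟨-, -, -, hV⟩ := hreg.objective hreal
  have hexp0 : M.expect (fun _ => 0) = 0 := by simp [expect]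
  ext i j
  rw [jacobian, LinearMap.toMatrix_apply, ContinuousLinearMap.coe_coe, hJ]
  rcases i with i | i <;> rcases j with j | j <;>
  simp only [Module.Basis.prod_repr_inl, Module.Basis.prod_repr_inr, Module.Basis.prod_apply,
    OrthonormalBasis.coe_toBasis_repr_apply, EuclideanSpace.basisFun_repr,
    OrthonormalBasis.coe_toBasis, EuclideanSpace.basisFun_apply, Sum.elim_inl, Sum.elim_inr,
    Function.comp_apply, LinearMap.inl_apply, LinearMap.inr_apply, saddleGradient_fst_apply,
    saddleGradient_snd_apply, hV, map_zero, mul_zero, zero_mul, sub_zero, zero_sub, add_zero,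
    zero_add, Matrix.smul_apply, Matrix.fromBlocks_apply₁₁, Matrix.fromBlocks_apply₁₂,
    Matrix.fromBlocks_apply₂₁, Matrix.fromBlocks_apply₂₂, Matrix.neg_apply,
    Matrix.transpose_apply, KEE, KEH, KHH, Matrix.of_apply, gradE, gradH, gradient_apply,
    smul_eq_mul]
  · simp only [mul_comm]
    ring
  · rw [hexp0]
    ring
  · rw [hexp0]
    ring
  · simp [expect, integral_neg, mul_comm]

/-- `K_HH` is the Gram matrix of the parameter derivatives of `H`. -/
lemma Regular.posSemidef_KHH (hreg : M.Regular θ₀ ω₀) (hreal : M.Realizable θ₀ ω₀) :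
    (M.KHH ω₀).PosSemidef := by
  obtain ⟨-, -, hint, -⟩ := hreg.objective hreal
  have hint' : ∀ i j, Integrable (fun x => M.p x * (M.gradH ω₀ x i * M.gradH ω₀ x j)) M.base := by
    intro i j
    have := (hint (0, EuclideanSpace.single i 1) (0, EuclideanSpace.single j 1)).neg
    simpa [Pi.neg_def, gradH, gradient_apply] using this
  refine Matrix.PosSemidef.of_dotProduct_mulVec_nonneg ?_ fun x => ?_
  · ext i j
    simp only [KHH, Matrix.conjTranspose_apply, Matrix.of_apply, star_trivial, mul_comm]
  · have h : star x ⬝ᵥ (M.KHH ω₀).mulVec x =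
        ∫ y, M.p y * (∑ i, x i * M.gradH ω₀ y i) ^ 2 ∂M.base := by
      have e : ∀ y, M.p y * (∑ i, x i * M.gradH ω₀ y i) ^ 2 =
          ∑ i, ∑ j, x i * x j * (M.p y * (M.gradH ω₀ y i * M.gradH ω₀ y j)) := by
        intro y
        rw [pow_two, Finset.sum_mul_sum, Finset.mul_sum]
        refine Finset.sum_congr rfl fun i _ => ?_
        rw [Finset.mul_sum]
        refine Finset.sum_congr rfl fun j _ => ?_
        ring
      simp only [e]
      rw [integral_finsetSum _ fun i _ => integrable_finsetSum _ fun j _ =>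
        (hint' i j).const_mul _]
      simp only [Matrix.mulVec, dotProduct, star_trivial, KHH, Matrix.of_apply, expect]
      refine Finset.sum_congr rfl fun i _ => ?_
      rw [integral_finsetSum _ fun j _ => (hint' i j).const_mul _, Finset.mul_sum]
      refine Finset.sum_congr rfl fun j _ => ?_
      rw [integral_const_mul]
      ring
    rw [h]
    exact integral_nonneg fun y => mul_nonneg (hreg.p_nonneg y) (sq_nonneg _)

end FEBM

end Jacobian

end

theorem mainTheorem1 {𝒳 : Type*} [MeasurableSpace 𝒳] {m n : ℕ} (hm : 0 < m)
    (M : FEBM 𝒳 m n) (θ₀ : EuclideanSpace ℝ (Fin m)) (ω₀ : EuclideanSpace ℝ (Fin n))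
    (hreg : M.Regular θ₀ ω₀)
    (hreal : M.Realizable θ₀ ω₀)
    (hEE : (M.KEE θ₀).PosSemidef)
    (hHH : FullColumnRank (M.KHH ω₀))
    (hEH : FullColumnRank (M.KEH θ₀ ω₀).transpose) :
    IsExponentiallyStable M.field (θ₀, ω₀) ∧
    DifferentiableAt ℝ M.field (θ₀, ω₀) ∧
    -- the attainable exponential rates are determined by the eigenvalues of the Jacobian
    (∀ r : ℝ, (∀ c ∈ M.jacobianEigenvalues (θ₀, ω₀), r < -c.re) →
      HasExponentialRate M.field (θ₀, ω₀) r) ∧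
    (∀ r : ℝ, HasExponentialRate M.field (θ₀, ω₀) r →
      ∀ c ∈ M.jacobianEigenvalues (θ₀, ω₀), r ≤ -c.re) ∧
    -- bounds on the eigenvalues
    ∀ c ∈ M.jacobianEigenvalues (θ₀, ω₀),
      c.re < 0 ∧
      (c.im = 0 →
        c.re < -(deriv (deriv M.f) 1 *
            (eigMin (M.KHH ω₀) * eigMin (M.KEH θ₀ ω₀ * (M.KEH θ₀ ω₀).transpose)) /
            (eigMin (M.KHH ω₀) * max (eigMax (M.KEE θ₀)) (eigMax (M.KHH ω₀)) +
              eigMin (M.KEH θ₀ ω₀ * (M.KEH θ₀ ω₀).transpose))) ∧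
        -(deriv (deriv M.f) 1 *
            (eigMin (M.KHH ω₀) * eigMin (M.KEH θ₀ ω₀ * (M.KEH θ₀ ω₀).transpose)) /
            (eigMin (M.KHH ω₀) * max (eigMax (M.KEE θ₀)) (eigMax (M.KHH ω₀)) +
              eigMin (M.KEH θ₀ ω₀ * (M.KEH θ₀ ω₀).transpose))) < 0) ∧
      (c.im ≠ 0 →
        c.re ≤ -(deriv (deriv M.f) 1 / 2 * (eigMin (M.KEE θ₀) + eigMin (M.KHH ω₀))) ∧
        -(deriv (deriv M.f) 1 / 2 * (eigMin (M.KEE θ₀) + eigMin (M.KHH ω₀))) < 0) := by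
  obtain ⟨hz, hF, -⟩ := hreg.field_props hreal
  have hbounds := fun (c : ℂ) (hc : c ∈ M.jacobianEigenvalues (θ₀, ω₀)) =>
    saddle_eigenvalue_bounds (k := deriv (deriv M.f) 1) (c := c) hm hEE
      (hreg.posSemidef_KHH hreal) hHH hEH hreg.generator.second_pos
      (by rwa [FEBM.jacobianEigenvalues, hreg.jacobian_eq hreal] at hc)
  obtain ⟨R, hR, K, hL⟩ := hF.exists_lipschitzOnWith
  obtain ⟨hstab, hrate, hrate'⟩ := isExponentiallyStable_of_eigenvalueSet
    ((EuclideanSpace.basisFun (Fin m) ℝ).toBasis.prod (EuclideanSpace.basisFun (Fin n) ℝ).toBasis)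
    hz hR hL hF.differentiableAt.hasFDerivAt fun c hc => (hbounds c hc).1
  exact ⟨hstab, hF.differentiableAt, hrate, hrate', hbounds⟩
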